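/- **Conventions.** For an integer $r\ge 0$, an *$r$-boundaried ILP* $(A,b,x_{t_1},\dots,x_{t_r})$ consists of a matrix $A\in\mathbb Z^{m\times n}$, a vector $b\in\mathbb Z^m$ and $r$ distinct *boundary variables* among the integer variables $x_1,\dots,x_n$ of the system $Ax\le b$. Its *feasible boundary assignments* are the vectors $a\in\mathbb Z^r$ for which there is $x\in\mathbb Z^n$ with $Ax\le b$ and $x_{t_k}=a_k$ for all $k$. Two $r$-boundaried ILPs are *equivalent* if they have the same feasible boundary assignments. The ILP has *domain size $d$* if for every variable $x_i$ the system contains constraints $-x_i\le -d'$ and $x_i\le d''$ with $d'\ge 0$ and $d''\le d-1$. A matrix is *totally unimodular* if every square submatrix has determinant in $\{-1,0,1\}$. Algorithms are programs (assignments, sequencing, conditionals and while-loops) on a random access machine with integer registers and integer arrays, where all memory outside the input is initially $0$ and where each arithmetic operation ($+,-,\cdot$, integer division), comparison and memory access costs one step. Matrices are stored in full, row by row. An *LP solver with runtime $g$* is such a program that decides, for all $n,m$ and all $A\in\mathbb Z^{m\times n}$, $b\in\mathbb Z^m$, whether $Ax\le b$ has a real solution, within $g(n,m)$ steps. **Lemma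 4.2.** There is an absolute constant $C$ such that, for every LP solver with runtime $g$, there is an algorithm with the following specifications. 1. It gets as input integers $r\ge 0$ and $d\ge 1$ and an $r$-boundaried ILP $(A,b,x_{t_1},\dots,x_{t_r})$ of domain size $d$, with $A\in\mathbb Z^{m\times n}$ and $b\in\mathbb Z^m$, such that the restriction of $A$ to the columns $[n]\setminus\{t_1,\dots,t_r\}$ is totally unimodular. 2. On such an input it halts after at most $C\cdot(d^r\cdot g(n,m)+d^{2r})$ steps. 3. Its output is an equivalent $r$-boundaried ILP $(A',b',x'_{t'_1},\dots,x'_{t'_r})$ of domain size $d$ with at most $C\cdot r\cdot d^r$ variables and at most $C\cdot\max(r,1)\cdot d^r$ constraints, in which all entries of $A'$ and $b'$ lie in $\{-d,\dots,d\}$. -/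

import Mathlib

/-! ### The machine: structured programs on a random access machine with uniform cost

The memory consists of integer registers `regs 0, regs 1, …` and of integer arrays
`arrs 0, arrs 1, …`, each indexed by `ℤ`. A program is a finite text, so it mentions only finitely
many registers and arrays by name; array cells are addressed by computed indices. Every arithmetic
operation, memory access, comparison and assignment costs one step, whatever the size of the
integers involved. -/

namespace RAM

/-- A memory state. -/
structure State where
  regs : ℕ → ℤ
  arrs : ℕ → ℤ → ℤ

/-- Integer expressions. -/
inductive Expr where
  | const (z : ℤ)
  | reg (x : ℕ)
  | get (a : ℕ) (i : Expr)
  | add (e₁ e₂ : Expr)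
  | sub (e₁ e₂ : Expr)
  | mul (e₁ e₂ : Expr)
  | div (e₁ e₂ : Expr)

/-- The value of an expression (`div` is integer division; division by zero yields zero). -/
def Expr.val (σ : State) : Expr → ℤ
  | .const z => z
  | .reg x => σ.regs x
  | .get a i => σ.arrs a (i.val σ)
  | .add e₁ e₂ => e₁.val σ + e₂.val σ
  | .sub e₁ e₂ => e₁.val σ - e₂.val σ
  | .mul e₁ e₂ => e₁.val σ * e₂.val σ
  | .div e₁ e₂ => e₁.val σ / e₂.val σ

/-- The number of steps needed to evaluate an expression: one for each constant, register access,
array access and arithmetic operation. -/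
def Expr.cost : Expr → ℕ
  | .const _ => 1
  | .reg _ => 1
  | .get _ i => i.cost + 1
  | .add e₁ e₂ => e₁.cost + e₂.cost + 1
  | .sub e₁ e₂ => e₁.cost + e₂.cost + 1
  | .mul e₁ e₂ => e₁.cost + e₂.cost + 1
  | .div e₁ e₂ => e₁.cost + e₂.cost + 1

/-- Programs. The tests of `cond` and `loop` compare two expressions by `≤`. -/
inductive Prog where
  | skip
  | assign (x : ℕ) (e : Expr)
  | store (a : ℕ) (i e : Expr)
  | seq (p q : Prog)
  | cond (e₁ e₂ : Expr) (p q : Prog)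
  | loop (e₁ e₂ : Expr) (p : Prog)

/-- Overwrite register `x` by `z`. -/
def State.setReg (σ : State) (x : ℕ) (z : ℤ) : State :=
  { σ with regs := Function.update σ.regs x z }

/-- Overwrite cell `i` of array `a` by `z`. -/
def State.setArr (σ : State) (a : ℕ) (i z : ℤ) : State :=
  { σ with arrs := Function.update σ.arrs a (Function.update (σ.arrs a) i z) }

/-- `Exec p σ t σ'`: started in the state `σ`, the program `p` halts after exactly `t` steps in the
state `σ'`. -/
inductive Exec : Prog → State → ℕ → State → Prop where
  | skip (σ : State) : Exec .skip σ 1 σ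
  | assign (σ : State) (x : ℕ) (e : Expr) :
      Exec (.assign x e) σ (e.cost + 1) (σ.setReg x (e.val σ))
  | store (σ : State) (a : ℕ) (i e : Expr) :
      Exec (.store a i e) σ (i.cost + e.cost + 1) (σ.setArr a (i.val σ) (e.val σ))
  | seq (p q : Prog) (σ₁ σ₂ σ₃ : State) (t₁ t₂ : ℕ)
      (h₁ : Exec p σ₁ t₁ σ₂) (h₂ : Exec q σ₂ t₂ σ₃) : Exec (.seq p q) σ₁ (t₁ + t₂) σ₃
  | condTrue (e₁ e₂ : Expr) (p q : Prog) (σ σ' : State) (t : ℕ)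
      (hc : e₁.val σ ≤ e₂.val σ) (h : Exec p σ t σ') :
      Exec (.cond e₁ e₂ p q) σ (e₁.cost + e₂.cost + 1 + t) σ'
  | condFalse (e₁ e₂ : Expr) (p q : Prog) (σ σ' : State) (t : ℕ)
      (hc : ¬ e₁.val σ ≤ e₂.val σ) (h : Exec q σ t σ') :
      Exec (.cond e₁ e₂ p q) σ (e₁.cost + e₂.cost + 1 + t) σ'
  | loopDone (e₁ e₂ : Expr) (p : Prog) (σ : State) (hc : ¬ e₁.val σ ≤ e₂.val σ) :
      Exec (.loop e₁ e₂ p) σ (e₁.cost + e₂.cost + 1) σ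
  | loopStep (e₁ e₂ : Expr) (p : Prog) (σ₁ σ₂ σ₃ : State) (t₁ t₂ : ℕ)
      (hc : e₁.val σ₁ ≤ e₂.val σ₁) (h₁ : Exec p σ₁ t₁ σ₂)
      (h₂ : Exec (.loop e₁ e₂ p) σ₂ t₂ σ₃) :
      Exec (.loop e₁ e₂ p) σ₁ (e₁.cost + e₂.cost + 1 + t₁ + t₂) σ₃

/-- The contents of an array holding the vector `v` in the cells `0, …, k - 1`, and zero
elsewhere. -/
def ofVec {k : ℕ} (v : Fin k → ℤ) : ℤ → ℤ :=
  fun z => ∑ i : Fin k, if z = (i : ℕ) then v i else 0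

/-- The contents of an array holding the `m × n` matrix `A` row by row (entry `(i, j)` in the cell
`i * n + j`), and zero elsewhere. -/
def ofMatrix {m n : ℕ} (A : Matrix (Fin m) (Fin n) ℤ) : ℤ → ℤ :=
  fun z => ∑ i : Fin m, ∑ j : Fin n, if z = (i : ℕ) * n + (j : ℕ) then A i j else 0

/-- Registers holding the given list of values, all further registers being zero. -/
def initRegs (l : List ℤ) : ℕ → ℤ := fun x => l.getD x 0

/-- Arrays with the given list of contents, all further arrays being zero. -/
def initArrs (l : List (ℤ → ℤ)) : ℕ → ℤ → ℤ := fun a => l.getD a 0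

end RAM

/-! ### Linear programs -/

/-- Feasibility of the linear program `A x ≤ b` over the reals. -/
def LPFeasible {m n : ℕ} (A : Matrix (Fin m) (Fin n) ℤ) (b : Fin m → ℤ) : Prop :=
  ∃ x : Fin n → ℝ, ∀ i, ∑ j, (A i j : ℝ) * x j ≤ (b i : ℝ)

/-- The initial memory of a solver for linear programs: `n` and `m` in the registers `0` and `1`,
the matrix in array `0`, the right-hand side in array `1`, and zero everywhere else. -/
def lpInput {m n : ℕ} (A : Matrix (Fin m) (Fin n) ℤ) (b : Fin m → ℤ) : RAM.State where
  regs := RAM.initRegs [(n : ℤ), (m : ℤ)]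
  arrs := RAM.initArrs [RAM.ofMatrix A, RAM.ofVec b]

/-- The program `S` decides feasibility of all linear programs (with integer data), and its running
time on linear programs with `n` variables and `m` constraints is at most `g n m`. The answer
"feasible" is given by the value `1` in register `0`. -/
def IsLPSolver (S : RAM.Prog) (g : ℕ → ℕ → ℕ) : Prop :=
  ∀ (n m : ℕ) (A : Matrix (Fin m) (Fin n) ℤ) (b : Fin m → ℤ),
    ∃ (t : ℕ) (σ : RAM.State), RAM.Exec S (lpInput A b) t σ ∧ t ≤ g n m ∧
      (σ.regs 0 = 1 ↔ LPFeasible A b)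

/-! ### Boundaried integer linear programs -/

/-- An `r`-boundaried ILP: a system `A x ≤ b` with `n` integer variables and `m` constraints, and
`r` distinct boundary variables `x (t 0), …, x (t (r - 1))`. -/
structure BoundariedILP (r : ℕ) where
  n : ℕ
  m : ℕ
  A : Matrix (Fin m) (Fin n) ℤ
  b : Fin m → ℤ
  t : Fin r ↪ Fin n

namespace BoundariedILP

/-- The assignments to the boundary variables that can be completed into an integer assignment
that is feasible for the entire system. -/
def feasibleBoundary {r : ℕ} (I : BoundariedILP r) : Set (Fin r → ℤ) :=
  {a | ∃ x : Fin I.n → ℤ, (∀ i, ∑ j, I.A i j * x j ≤ I.b i) ∧ ∀ k, x (I.t k) = a k}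

/-- Two `r`-boundaried ILPs are equivalent if they have the same feasible boundary assignments. -/
def Equivalent {r : ℕ} (I J : BoundariedILP r) : Prop :=
  I.feasibleBoundary = J.feasibleBoundary

/-- Domain size `d`: for every variable `x j`, constraints `-x j ≤ -d'` and `x j ≤ d''` with
`0 ≤ d'` and `d'' ≤ d - 1` are among the constraints of the system. -/
def HasDomainSize {r : ℕ} (I : BoundariedILP r) (d : ℕ) : Prop :=
  ∀ j : Fin I.n,
    (∃ i, I.A i = -Pi.single j 1 ∧ ∃ d' : ℤ, 0 ≤ d' ∧ I.b i = -d') ∧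
    (∃ i, I.A i = Pi.single j 1 ∧ ∃ d'' : ℤ, d'' ≤ (d : ℤ) - 1 ∧ I.b i = d'')

/-- The restriction of the constraint matrix to the columns of the non-boundary variables. -/
def innerMatrix {r : ℕ} (I : BoundariedILP r) :
    Matrix (Fin I.m) {j : Fin I.n // j ∉ Set.range I.t} ℤ :=
  I.A.submatrix id Subtype.val

/-- All entries of `(A, b)` lie in `{-d, …, d}`. -/
def EntriesBounded {r : ℕ} (I : BoundariedILP r) (d : ℕ) : Prop :=
  (∀ i j, -(d : ℤ) ≤ I.A i j ∧ I.A i j ≤ d) ∧ ∀ i, -(d : ℤ) ≤ I.b i ∧ I.b i ≤ d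

/-- The initial memory for the input `I` with domain size `d`: `n, m, r, d` in the registers
`0, 1, 2, 3`, the matrix, the right-hand side and the (zero-based) indices of the boundary variables
in the arrays `0, 1, 2`, and zero everywhere else. -/
def input {r : ℕ} (I : BoundariedILP r) (d : ℕ) : RAM.State where
  regs := RAM.initRegs [(I.n : ℤ), (I.m : ℤ), (r : ℤ), (d : ℤ)]
  arrs := RAM.initArrs [RAM.ofMatrix I.A, RAM.ofVec I.b, RAM.ofVec fun k => ((I.t k : ℕ) : ℤ)]

/-- The memory `σ` holds the boundaried ILP `J` as an output: the numbers of variables and of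
constraints in the registers `0` and `1`, and the full matrix (row by row), the right-hand side and
the indices of the boundary variables in the arrays `3, 4, 5`. -/
def IsOutput {r : ℕ} (J : BoundariedILP r) (σ : RAM.State) : Prop :=
  σ.regs 0 = J.n ∧ σ.regs 1 = J.m ∧
    (∀ (i : Fin J.m) (j : Fin J.n), σ.arrs 3 ((i : ℕ) * J.n + (j : ℕ)) = J.A i j) ∧
    (∀ i : Fin J.m, σ.arrs 4 (i : ℕ) = J.b i) ∧
    (∀ k : Fin r, σ.arrs 5 (k : ℕ) = ((J.t k : ℕ) : ℤ))

end BoundariedILP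

/-! Substitute one of the `d ^ r` vectors with entries in `{0, …, d - 1}` for the boundary
variables. What remains is a system with totally unimodular matrix and integral right-hand side,
bounded by the domain constraints. It therefore has an integral solution as soon as it has a real
one: an extreme point of the polyhedron solves a square subsystem of determinant `±1`
(`Matrix.IsTotallyUnimodular.exists_int`, `BoundariedILP.lpFeasible_fixed_iff`). So `d ^ r` calls of
the LP solver determine all feasible boundary assignments. The boundary columns are zeroed instead
of deleted, so every call has exactly the dimensions `n` and `m`, and `g` need not be monotone.

The output lists the answers. Each assignment except the all-zero one gets an indicator variable
with lower bound `0` and upper bound `1` or `0`, according to feasibility. The indicators sum to at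
most `1`, and each boundary variable equals the sum of the corresponding base-`d` digits weighted by
the indicators. Having no indicator set stands for the zero assignment; it is excluded, when
infeasible, by requiring the sum to be at least `1` (`mem_feasibleBoundary_outILP`). Saving that one
indicator gives no variables at all for `r = 0`, and no indicators for `d = 1`, where an upper bound
`1` would violate the domain size.

Two points concern the running time. First, the input has to be copied for each call, although the
bound contains no term for the input size. This is paid by `g`: an LP solver must read every cell of
a suitable feasible instance, since changing any one entry of it destroys feasibility
(`IsLPSolver.le_runtime`). The argument needs `2 * n ≤ m`, which the domain constraints guarantee.
Second, the solver expects memory that is zero outside its input, but its earlier runs leave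
garbage. It is therefore simulated inside one array with a log of all written cells
(`Exec.translate`), and clearing the logged cells costs no more than a constant times the writes
that were made. -/

namespace RAM

/-! ### A calculus for total correctness with running times -/

@[simp] theorem State.setReg_regs (σ : State) (x : ℕ) (z : ℤ) (y : ℕ) :
    (σ.setReg x z).regs y = if y = x then z else σ.regs y := by
  simp [State.setReg, Function.update_apply]

@[simp] theorem State.setReg_arrs (σ : State) (x : ℕ) (z : ℤ) :
    (σ.setReg x z).arrs = σ.arrs := rfl

@[simp] theorem State.setArr_regs (σ : State) (a : ℕ) (i z : ℤ) :
    (σ.setArr a i z).regs = σ.regs := rfl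

theorem State.setArr_arrs (σ : State) (a : ℕ) (i z : ℤ) (b : ℕ) (j : ℤ) :
    (σ.setArr a i z).arrs b j = if b = a ∧ j = i then z else σ.arrs b j := by
  simp only [State.setArr, Function.update_apply]
  split_ifs with h₁ h₂ h₃ <;> simp_all

@[simp] theorem State.setArr_arrs_self (σ : State) (a : ℕ) (i z : ℤ) (j : ℤ) :
    (σ.setArr a i z).arrs a j = if j = i then z else σ.arrs a j := by
  simp [State.setArr_arrs]

theorem State.setArr_arrs_of_ne (σ : State) {a b : ℕ} (i z : ℤ) (h : b ≠ a) :
    (σ.setArr a i z).arrs b = σ.arrs b := by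
  funext j; simp [State.setArr_arrs, h]

/-- Started in `σ`, the program `p` halts within `T` steps in a state satisfying `Q`. -/
def Halts (p : Prog) (σ : State) (T : ℕ) (Q : State → Prop) : Prop :=
  ∃ (t : ℕ) (σ' : State), Exec p σ t σ' ∧ t ≤ T ∧ Q σ'

/-- The program may write the register `x`. -/
def Prog.WritesReg (x : ℕ) : Prog → Prop
  | .skip => False
  | .assign y _ => x = y
  | .store _ _ _ => False
  | .seq p q => p.WritesReg x ∨ q.WritesReg x
  | .cond _ _ p q => p.WritesReg x ∨ q.WritesReg x
  | .loop _ _ p => p.WritesReg x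

/-- The program may write the array `a`. -/
def Prog.WritesArr (a : ℕ) : Prog → Prop
  | .skip => False
  | .assign _ _ => False
  | .store b _ _ => a = b
  | .seq p q => p.WritesArr a ∨ q.WritesArr a
  | .cond _ _ p q => p.WritesArr a ∨ q.WritesArr a
  | .loop _ _ p => p.WritesArr a

/-- The states agree on everything that `p` cannot write. -/
structure Frame (p : Prog) (σ σ' : State) : Prop where
  regs : ∀ x, ¬ p.WritesReg x → σ'.regs x = σ.regs x
  arrs : ∀ a, ¬ p.WritesArr a → σ'.arrs a = σ.arrs a

theorem Frame.refl (p : Prog) (σ : State) : Frame p σ σ := ⟨fun _ _ => rfl, fun _ _ => rfl⟩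

theorem Frame.trans {p : Prog} {σ₁ σ₂ σ₃ : State} (h₁ : Frame p σ₁ σ₂) (h₂ : Frame p σ₂ σ₃) :
    Frame p σ₁ σ₃ :=
  ⟨fun x hx => (h₂.regs x hx).trans (h₁.regs x hx),
    fun a ha => (h₂.arrs a ha).trans (h₁.arrs a ha)⟩

/-- This makes the specifications modular: an invariant has to speak only of memory that the program
at hand can write, and everything else is carried over by a syntactic check. -/
theorem Exec.frame {p : Prog} {σ σ' : State} {t : ℕ} (h : Exec p σ t σ') : Frame p σ σ' := by
  induction h with
  | skip σ => exact .refl _ _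
  | assign σ x e =>
    refine ⟨fun y hy => ?_, fun a _ => rfl⟩
    have : y ≠ x := hy
    simp [this]
  | store σ a i e =>
    refine ⟨fun y _ => rfl, fun b hb => ?_⟩
    exact State.setArr_arrs_of_ne _ _ _ hb
  | seq p q σ₁ σ₂ σ₃ t₁ t₂ _ _ ih₁ ih₂ =>
    refine ⟨fun x hx => ?_, fun a ha => ?_⟩
    · have hx := not_or.1 hx
      rw [ih₂.regs x hx.2, ih₁.regs x hx.1]
    · have ha := not_or.1 ha
      rw [ih₂.arrs a ha.2, ih₁.arrs a ha.1]
  | condTrue e₁ e₂ p q σ σ' t _ _ ih =>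
    exact ⟨fun x hx => ih.regs x (not_or.1 hx).1, fun a ha => ih.arrs a (not_or.1 ha).1⟩
  | condFalse e₁ e₂ p q σ σ' t _ _ ih =>
    exact ⟨fun x hx => ih.regs x (not_or.1 hx).2, fun a ha => ih.arrs a (not_or.1 ha).2⟩
  | loopDone => exact .refl _ _
  | loopStep e₁ e₂ p σ₁ σ₂ σ₃ t₁ t₂ _ _ _ ih₁ ih₂ =>
    refine ⟨fun x hx => ?_, fun a ha => ?_⟩
    · rw [ih₂.regs x hx, ih₁.regs x hx]
    · rw [ih₂.arrs a ha, ih₁.arrs a ha]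

theorem Halts.mono {p : Prog} {σ : State} {T T' : ℕ} {Q Q' : State → Prop}
    (h : Halts p σ T Q) (hT : T ≤ T') (hQ : ∀ σ', Frame p σ σ' → Q σ' → Q' σ') :
    Halts p σ T' Q' := by
  obtain ⟨t, σ', he, ht, hq⟩ := h
  exact ⟨t, σ', he, ht.trans hT, hQ _ he.frame hq⟩

theorem Halts.assign {σ : State} {x : ℕ} {e : Expr} {T : ℕ} {Q : State → Prop}
    (hT : e.cost + 1 ≤ T) (hQ : Q (σ.setReg x (e.val σ))) : Halts (.assign x e) σ T Q :=
  ⟨_, _, .assign σ x e, hT, hQ⟩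

theorem Halts.store {σ : State} {a : ℕ} {i e : Expr} {T : ℕ} {Q : State → Prop}
    (hT : i.cost + e.cost + 1 ≤ T) (hQ : Q (σ.setArr a (i.val σ) (e.val σ))) :
    Halts (.store a i e) σ T Q :=
  ⟨_, _, .store σ a i e, hT, hQ⟩

theorem Halts.seq {p q : Prog} {σ : State} (T₁ T₂ : ℕ) {T : ℕ} {Q : State → Prop}
    (hT : T₁ + T₂ ≤ T)
    (h : Halts p σ T₁ fun σ' => Halts q σ' T₂ Q) : Halts (.seq p q) σ T Q := by
  obtain ⟨t₁, σ', h₁, ht₁, t₂, σ'', h₂, ht₂, hQ⟩ := h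
  exact ⟨_, _, .seq _ _ _ _ _ _ _ h₁ h₂, by omega, hQ⟩

theorem Halts.assign_seq {q : Prog} {σ : State} {x : ℕ} {e : Expr} {T : ℕ} {Q : State → Prop}
    (hT : e.cost + 1 ≤ T) (h : Halts q (σ.setReg x (e.val σ)) (T - (e.cost + 1)) Q) :
    Halts (.seq (.assign x e) q) σ T Q :=
  .seq _ _ (by omega) (.assign le_rfl h)

theorem Halts.store_seq {q : Prog} {σ : State} {a : ℕ} {i e : Expr} {T : ℕ} {Q : State → Prop}
    (hT : i.cost + e.cost + 1 ≤ T)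
    (h : Halts q (σ.setArr a (i.val σ) (e.val σ)) (T - (i.cost + e.cost + 1)) Q) :
    Halts (.seq (.store a i e) q) σ T Q :=
  .seq _ _ (by omega) (.store le_rfl h)

theorem Halts.cond {e₁ e₂ : Expr} {p q : Prog} {σ : State} {T : ℕ} {Q : State → Prop}
    (hT : e₁.cost + e₂.cost + 1 ≤ T)
    (h₁ : e₁.val σ ≤ e₂.val σ → Halts p σ (T - (e₁.cost + e₂.cost + 1)) Q)
    (h₂ : ¬ e₁.val σ ≤ e₂.val σ → Halts q σ (T - (e₁.cost + e₂.cost + 1)) Q) :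
    Halts (.cond e₁ e₂ p q) σ T Q := by
  by_cases hc : e₁.val σ ≤ e₂.val σ
  · obtain ⟨t, σ', h, ht, hQ⟩ := h₁ hc
    exact ⟨_, _, .condTrue _ _ _ _ _ _ _ hc h, by omega, hQ⟩
  · obtain ⟨t, σ', h, ht, hQ⟩ := h₂ hc
    exact ⟨_, _, .condFalse _ _ _ _ _ _ _ hc h, by omega, hQ⟩

/-- The register `x` runs through the values below the one in register `y`. -/
def forLoop (x y : ℕ) (p : Prog) : Prog :=
  .seq (.assign x (.const 0))
    (.loop (.add (.reg x) (.const 1)) (.reg y)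
      (.seq p (.assign x (.add (.reg x) (.const 1)))))

/-- Each round pays 5 steps for the test and 4 for the increment; the initialisation and the last
test cost 2 + 5. The invariant is required after the counter has advanced, and the frame relation to
`σ₀` spares it from mentioning memory that the loop leaves alone. -/
theorem Halts.forLoop {x y N T : ℕ} {p : Prog} {σ₀ : State} (Inv : ℕ → State → Prop)
    (hN : σ₀.regs y = N) (hxy : y ≠ x) (hx : ¬ p.WritesReg x) (hy : ¬ p.WritesReg y)
    (h₀ : Inv 0 (σ₀.setReg x 0))
    (hstep : ∀ k < N, ∀ σ, Frame (RAM.forLoop x y p) σ₀ σ → σ.regs x = k → Inv k σ →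
      Halts p σ T fun σ' => Inv (k + 1) (σ'.setReg x (k + 1))) :
    Halts (RAM.forLoop x y p) σ₀ (N * (T + 9) + 7) fun σ => Inv N σ := by
  have key : ∀ l k : ℕ, k + l = N → ∀ σ, Frame (RAM.forLoop x y p) σ₀ σ → σ.regs x = k →
      Inv k σ → Halts (.loop (.add (.reg x) (.const 1)) (.reg y)
        (.seq p (.assign x (.add (.reg x) (.const 1))))) σ (l * (T + 9) + 5)
        fun σ => Inv N σ := by
    intro l
    induction l with
    | zero =>
      intro k hk σ hf hσ hI
      have hy' : σ.regs y = N := by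
        rw [hf.regs y (by simp [RAM.forLoop, Prog.WritesReg, hxy, hy]), hN]
      refine ⟨_, _, .loopDone _ _ _ _ ?_, ?_, ?_⟩
      · simp only [Expr.val, hσ, hy']; omega
      · simp [Expr.cost]
      · obtain rfl : k = N := by omega
        exact hI
    | succ l ih =>
      intro k hk σ hf hσ hI
      have hy' : σ.regs y = N := by
        rw [hf.regs y (by simp [RAM.forLoop, Prog.WritesReg, hxy, hy]), hN]
      obtain ⟨t, σ', he, ht, hI'⟩ := hstep k (by omega) σ hf hσ hI
      have hσ' : σ'.regs x = k := by rw [he.frame.regs x hx, hσ]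
      have e2 : Exec (.seq p (.assign x (.add (.reg x) (.const 1)))) σ (t + 4)
          (σ'.setReg x (k + 1)) := by
        have := Exec.assign σ' x (.add (.reg x) (.const 1))
        simp only [Expr.val, Expr.cost, hσ'] at this
        exact .seq _ _ _ _ _ _ _ he this
      have hf' : Frame (RAM.forLoop x y p) σ₀ (σ'.setReg x (k + 1)) := by
        refine hf.trans ⟨fun z hz => ?_, fun a ha => ?_⟩
        · exact e2.frame.regs z fun h => hz (.inr h)
        · exact e2.frame.arrs a fun h => ha (.inr h)
      obtain ⟨t', σ'', he', ht', hQ⟩ := ih (k + 1) (by omega) _ hf' (by simp) hI'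
      refine ⟨_, _, .loopStep _ _ _ _ _ _ _ _ ?_ e2 he', ?_, hQ⟩
      · simp only [Expr.val, hσ, hy']; omega
      · simp only [Expr.cost]; nlinarith
  refine Halts.seq 2 (N * (T + 9) + 5) (by omega) (.assign (by simp [Expr.cost]) ?_)
  refine key N 0 (by omega) _ ⟨fun z hz => ?_, fun a ha => rfl⟩ (by simp [Expr.val]) h₀
  have : z ≠ x := fun h => hz (.inl h)
  simp [this]

/-- A solver is only specified by the existence of a correct run. Determinism transfers the
correctness to every run that is exhibited by other means. -/
theorem Exec.det {p : Prog} {σ σ₁ : State} {t₁ : ℕ} (h₁ : Exec p σ t₁ σ₁) :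
    ∀ {t₂ : ℕ} {σ₂ : State}, Exec p σ t₂ σ₂ → t₁ = t₂ ∧ σ₁ = σ₂ := by
  induction h₁ with
  | skip σ => intro t₂ σ₂ h; cases h; exact ⟨rfl, rfl⟩
  | assign σ x e => intro t₂ σ₂ h; cases h; exact ⟨rfl, rfl⟩
  | store σ a i e => intro t₂ σ₂ h; cases h; exact ⟨rfl, rfl⟩
  | seq p q σ₁ σ₂ σ₃ t₁ t₂ _ _ ih₁ ih₂ =>
    intro t σ h
    cases h with
    | seq _ _ _ _ _ _ _ g₁ g₂ =>
      obtain ⟨rfl, rfl⟩ := ih₁ g₁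
      obtain ⟨rfl, rfl⟩ := ih₂ g₂
      exact ⟨rfl, rfl⟩
  | condTrue e₁ e₂ p q σ σ' t hc _ ih =>
    intro t σ h
    cases h with
    | condTrue _ _ _ _ _ _ _ _ g => obtain ⟨rfl, rfl⟩ := ih g; exact ⟨rfl, rfl⟩
    | condFalse _ _ _ _ _ _ _ hc' g => exact absurd hc hc'
  | condFalse e₁ e₂ p q σ σ' t hc _ ih =>
    intro t σ h
    cases h with
    | condTrue _ _ _ _ _ _ _ hc' g => exact absurd hc' hc
    | condFalse _ _ _ _ _ _ _ _ g => obtain ⟨rfl, rfl⟩ := ih g; exact ⟨rfl, rfl⟩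
  | loopDone e₁ e₂ p σ hc =>
    intro t σ h
    cases h with
    | loopDone => exact ⟨rfl, rfl⟩
    | loopStep _ _ _ _ _ _ _ _ hc' => exact absurd hc' hc
  | loopStep e₁ e₂ p σ₁ σ₂ σ₃ t₁ t₂ hc _ _ ih₁ ih₂ =>
    intro t σ h
    cases h with
    | loopDone _ _ _ _ hc' => exact absurd hc hc'
    | loopStep _ _ _ _ _ _ _ _ _ g₁ g₂ =>
      obtain ⟨rfl, rfl⟩ := ih₁ g₁
      obtain ⟨rfl, rfl⟩ := ih₂ g₂
      exact ⟨rfl, rfl⟩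

theorem Exec.one_le {p : Prog} {σ σ' : State} {t : ℕ} (h : Exec p σ t σ') : 1 ≤ t := by
  induction h <;> omega

end RAM

namespace RAM

/-! ### The memory cells read by an execution -/

/-- The array cells read by an expression. -/
def Expr.reads (σ : State) : Expr → Finset (ℕ × ℤ)
  | .const _ => ∅
  | .reg _ => ∅
  | .get a i => insert (a, i.val σ) (i.reads σ)
  | .add e₁ e₂ => e₁.reads σ ∪ e₂.reads σ
  | .sub e₁ e₂ => e₁.reads σ ∪ e₂.reads σ
  | .mul e₁ e₂ => e₁.reads σ ∪ e₂.reads σ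
  | .div e₁ e₂ => e₁.reads σ ∪ e₂.reads σ

theorem Expr.card_reads_le (σ : State) (e : Expr) : (e.reads σ).card ≤ e.cost := by
  induction e with
  | const | reg => simp [reads]
  | get a i ih => exact (Finset.card_insert_le _ _).trans (by simpa [cost] using ih)
  | add e₁ e₂ h₁ h₂ | sub e₁ e₂ h₁ h₂ | mul e₁ e₂ h₁ h₂ | div e₁ e₂ h₁ h₂ =>
    exact (Finset.card_union_le _ _).trans (by simp only [cost]; omega)

/-- Addresses are computed, so the set of cells read depends on the state. By induction the index of
an array access has the same value in both states, hence the same cell is read. -/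
theorem Expr.val_congr {σ τ : State} (hr : τ.regs = σ.regs) (e : Expr)
    (h : ∀ c ∈ e.reads σ, τ.arrs c.1 c.2 = σ.arrs c.1 c.2) : e.val τ = e.val σ := by
  induction e with
  | const => rfl
  | reg => simp [val, hr]
  | get a i ih =>
    have hi := ih fun c hc => h c (Finset.mem_insert_of_mem hc)
    simp only [val, hi]
    exact h (a, i.val σ) (Finset.mem_insert_self _ _)
  | add e₁ e₂ h₁ h₂ | sub e₁ e₂ h₁ h₂ | mul e₁ e₂ h₁ h₂ | div e₁ e₂ h₁ h₂ =>
    simp only [val, h₁ fun c hc => h c (Finset.mem_union_left _ hc),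
      h₂ fun c hc => h c (Finset.mem_union_right _ hc)]

/-- An execution of `t` steps depends on at most `t` array cells. -/
theorem Exec.exists_reads {p : Prog} {σ σ' : State} {t : ℕ} (h : Exec p σ t σ') :
    ∃ R : Finset (ℕ × ℤ), R.card ≤ t ∧ ∀ τ : State, τ.regs = σ.regs →
      (∀ c ∈ R, τ.arrs c.1 c.2 = σ.arrs c.1 c.2) → ∃ τ' : State, Exec p τ t τ' ∧
        τ'.regs = σ'.regs ∧
        ∀ a z, τ.arrs a z = σ.arrs a z → τ'.arrs a z = σ'.arrs a z := by
  induction h with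
  | skip σ => exact ⟨∅, by simp, fun τ hr _ => ⟨τ, .skip τ, hr, fun _ _ h => h⟩⟩
  | assign σ x e =>
    refine ⟨e.reads σ, (e.card_reads_le σ).trans (by omega), fun τ hr hc =>
      ⟨_, .assign τ x e, ?_, fun _ _ h => h⟩⟩
    rw [Expr.val_congr hr e hc]
    simp [State.setReg, hr]
  | store σ a i e =>
    refine ⟨i.reads σ ∪ e.reads σ, (Finset.card_union_le _ _).trans ?_, fun τ hr hc =>
      ⟨_, .store τ a i e, hr, fun b z hz => ?_⟩⟩
    · have := i.card_reads_le σ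
      have := e.card_reads_le σ
      omega
    · rw [Expr.val_congr hr i fun c h => hc c (Finset.mem_union_left _ h),
        Expr.val_congr hr e fun c h => hc c (Finset.mem_union_right _ h)]
      simp [State.setArr_arrs, hz]
  | seq p q σ₁ σ₂ σ₃ t₁ t₂ _ _ ih₁ ih₂ =>
    obtain ⟨R₁, c₁, h₁⟩ := ih₁
    obtain ⟨R₂, c₂, h₂⟩ := ih₂
    refine ⟨R₁ ∪ R₂, (Finset.card_union_le _ _).trans (by omega), fun τ hr hc => ?_⟩
    obtain ⟨τ', e₁, hr₁, ha₁⟩ := h₁ τ hr fun c h => hc c (Finset.mem_union_left _ h)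
    by_cases hR : ∀ c ∈ R₂, τ'.arrs c.1 c.2 = σ₂.arrs c.1 c.2
    · obtain ⟨τ'', e₂, hr₂, ha₂⟩ := h₂ τ' hr₁ hR
      exact ⟨τ'', .seq _ _ _ _ _ _ _ e₁ e₂, hr₂, fun a z h => ha₂ a z (ha₁ a z h)⟩
    -- Cells of `R₂` agree before `p` runs, and agreement of a cell is never lost, so this case is
    -- impossible.
    · push Not at hR
      obtain ⟨c, hcR, hne⟩ := hR
      exact absurd (ha₁ c.1 c.2 (hc c (Finset.mem_union_right _ hcR))) hne
  | condTrue e₁ e₂ p q σ σ' t hle _ ih =>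
    obtain ⟨R, c, h⟩ := ih
    refine ⟨e₁.reads σ ∪ e₂.reads σ ∪ R, ?_, fun τ hr hc => ?_⟩
    · have := e₁.card_reads_le σ
      have := e₂.card_reads_le σ
      have := Finset.card_union_le (e₁.reads σ ∪ e₂.reads σ) R
      have := Finset.card_union_le (e₁.reads σ) (e₂.reads σ)
      omega
    · simp only [Finset.mem_union] at hc
      obtain ⟨τ', e, hr', ha⟩ := h τ hr fun c h => hc c (.inr h)
      refine ⟨τ', .condTrue _ _ _ _ _ _ _ ?_ e, hr', ha⟩
      rwa [Expr.val_congr hr e₁ fun c h => hc c (.inl (.inl h)),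
        Expr.val_congr hr e₂ fun c h => hc c (.inl (.inr h))]
  | condFalse e₁ e₂ p q σ σ' t hle _ ih =>
    obtain ⟨R, c, h⟩ := ih
    refine ⟨e₁.reads σ ∪ e₂.reads σ ∪ R, ?_, fun τ hr hc => ?_⟩
    · have := e₁.card_reads_le σ
      have := e₂.card_reads_le σ
      have := Finset.card_union_le (e₁.reads σ ∪ e₂.reads σ) R
      have := Finset.card_union_le (e₁.reads σ) (e₂.reads σ)
      omega
    · simp only [Finset.mem_union] at hc
      obtain ⟨τ', e, hr', ha⟩ := h τ hr fun c h => hc c (.inr h)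
      refine ⟨τ', .condFalse _ _ _ _ _ _ _ ?_ e, hr', ha⟩
      rwa [Expr.val_congr hr e₁ fun c h => hc c (.inl (.inl h)),
        Expr.val_congr hr e₂ fun c h => hc c (.inl (.inr h))]
  | loopDone e₁ e₂ p σ hle =>
    refine ⟨e₁.reads σ ∪ e₂.reads σ, (Finset.card_union_le _ _).trans ?_, fun τ hr hc =>
      ⟨τ, .loopDone _ _ _ _ ?_, hr, fun _ _ h => h⟩⟩
    · have := e₁.card_reads_le σ
      have := e₂.card_reads_le σ
      omega
    · simp only [Finset.mem_union] at hc
      rwa [Expr.val_congr hr e₁ fun c h => hc c (.inl h),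
        Expr.val_congr hr e₂ fun c h => hc c (.inr h)]
  | loopStep e₁ e₂ p σ₁ σ₂ σ₃ t₁ t₂ hle _ _ ih₁ ih₂ =>
    obtain ⟨R₁, c₁, h₁⟩ := ih₁
    obtain ⟨R₂, c₂, h₂⟩ := ih₂
    refine ⟨e₁.reads σ₁ ∪ e₂.reads σ₁ ∪ (R₁ ∪ R₂), ?_, fun τ hr hc => ?_⟩
    · have := e₁.card_reads_le σ₁
      have := e₂.card_reads_le σ₁
      have := Finset.card_union_le (e₁.reads σ₁ ∪ e₂.reads σ₁) (R₁ ∪ R₂)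
      have := Finset.card_union_le (e₁.reads σ₁) (e₂.reads σ₁)
      have := Finset.card_union_le R₁ R₂
      omega
    · simp only [Finset.mem_union] at hc
      obtain ⟨τ', g₁, hr₁, ha₁⟩ := h₁ τ hr fun c h => hc c (.inr (.inl h))
      obtain ⟨τ'', g₂, hr₂, ha₂⟩ := h₂ τ' hr₁ fun c h => ha₁ _ _ (hc c (.inr (.inr h)))
      refine ⟨τ'', .loopStep _ _ _ _ _ _ _ _ ?_ g₁ g₂, hr₂, fun a z h => ha₂ a z (ha₁ a z h)⟩
      rwa [Expr.val_congr hr e₁ fun c h => hc c (.inl (.inl h)),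
        Expr.val_congr hr e₂ fun c h => hc c (.inl (.inr h))]

end RAM

theorem lpInput_regs {m n : ℕ} (A : Matrix (Fin m) (Fin n) ℤ) (b : Fin m → ℤ) :
    (lpInput A b).regs = RAM.initRegs [(n : ℤ), (m : ℤ)] := rfl

theorem lpInput_arrs_zero {m n : ℕ} (A : Matrix (Fin m) (Fin n) ℤ) (b : Fin m → ℤ) :
    (lpInput A b).arrs 0 = RAM.ofMatrix A := rfl

theorem lpInput_arrs_one {m n : ℕ} (A : Matrix (Fin m) (Fin n) ℤ) (b : Fin m → ℤ) :
    (lpInput A b).arrs 1 = RAM.ofVec b := rfl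

theorem lpInput_arrs_add_two {m n : ℕ} (A : Matrix (Fin m) (Fin n) ℤ) (b : Fin m → ℤ) (a : ℕ) :
    (lpInput A b).arrs (a + 2) = 0 := by
  simp [lpInput, RAM.initArrs]

/-! ### LP solvers read their entire input -/

/-- The matrix with the constraints `x j ≤ 1`, then `-x j ≤ -1`, then `0 ≤ 0`. -/
def tightMatrix (m n : ℕ) : Matrix (Fin m) (Fin n) ℤ := fun i j =>
  if (i : ℕ) = j then 1 else if (i : ℕ) = n + j then -1 else 0

/-- The constraints of `tightMatrix` with the right-hand side that makes `(1, …, 1)` tight. -/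
def tightRhs (m n : ℕ) : Fin m → ℤ := fun i => ∑ j, tightMatrix m n i j

/-- `tightMatrix` with one entry increased by one. -/
def bumpedMatrix (m n : ℕ) (i : Fin m) (j : Fin n) : Matrix (Fin m) (Fin n) ℤ := fun i' j' =>
  tightMatrix m n i' j' + if i' = i ∧ j' = j then 1 else 0

/-- `tightRhs` with one entry decreased by one. -/
def bumpedRhs (m n : ℕ) (i : Fin m) : Fin m → ℤ := fun i' =>
  tightRhs m n i' - if i' = i then 1 else 0

theorem IsLPSolver.regs_eq_one_iff {S : RAM.Prog} {g : ℕ → ℕ → ℕ} (hS : IsLPSolver S g) {m n t : ℕ}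
    {A : Matrix (Fin m) (Fin n) ℤ} {b : Fin m → ℤ} {σ : RAM.State}
    (h : RAM.Exec S (lpInput A b) t σ) : σ.regs 0 = 1 ↔ LPFeasible A b := by
  obtain ⟨t', σ', h', -, hσ'⟩ := hS n m A b
  obtain ⟨rfl, rfl⟩ := h.det h'
  exact hσ'

theorem tightMatrix_feasible (m n : ℕ) :
    LPFeasible (tightMatrix m n) (tightRhs m n) :=
  ⟨fun _ => 1, fun i => by simp [tightRhs]⟩

/-- Tampering with row `i` spoils at most one of the inequalities `x j ≤ 1` and `1 ≤ x j`; all other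
rows still enforce theirs. -/
theorem tightMatrix_forces {m n : ℕ} (hmn : 2 * n ≤ m) (i : Fin m)
    (A : Matrix (Fin m) (Fin n) ℤ) (b : Fin m → ℤ)
    (hA : ∀ i' ≠ i, A i' = tightMatrix m n i' ∧ b i' = tightRhs m n i')
    (x : Fin n → ℝ) (hx : ∀ i, ∑ j, (A i j : ℝ) * x j ≤ (b i : ℝ)) (j : Fin n) :
    ((i : ℕ) ≠ j → x j ≤ 1) ∧ ((i : ℕ) ≠ n + j → 1 ≤ x j) := by
  constructor
  · intro h
    obtain ⟨e₁, e₂⟩ := hA ⟨j, by omega⟩ (fun h' => h (by rw [← h']))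
    have := hx ⟨j, by omega⟩
    rw [e₁, e₂, tightRhs] at this
    have e : tightMatrix m n ⟨j, by omega⟩ = Pi.single j 1 := by
      funext k
      have : (j : ℕ) ≠ n + k := by omega
      simp [tightMatrix, Pi.single_apply, Fin.ext_iff, this, eq_comm]
    simpa [e, Pi.single_apply] using this
  · intro h
    obtain ⟨e₁, e₂⟩ := hA ⟨n + j, by omega⟩ (fun h' => h (by rw [← h']))
    have := hx ⟨n + j, by omega⟩
    rw [e₁, e₂, tightRhs] at this
    have e : tightMatrix m n ⟨n + j, by omega⟩ = -Pi.single j 1 := by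
      funext k
      have : n + (j : ℕ) ≠ k := by omega
      simp [tightMatrix, Pi.single_apply, Fin.ext_iff, this, eq_comm]
      split_ifs <;> rfl
    simpa [e, Pi.single_apply] using this

/-- The new row `i` fails in each case. If it was `x k ≤ 1`, it now reads `x k + x j ≤ 1`, while all
variables are at least `1`. If it was `-x k ≤ -1`, it reads `-x k + x j ≤ -1`, which is `0 ≤ -1` for
`j = k` and otherwise contradicts `x k ≤ 1 ≤ x j`. If it was `0 ≤ 0`, it reads `x j ≤ 0`, while `x j
= 1`. -/
theorem not_feasible_update_matrix {m n : ℕ} (hmn : 2 * n ≤ m) (i : Fin m) (j : Fin n) :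
    ¬ LPFeasible (bumpedMatrix m n i j) (tightRhs m n) := by
  rintro ⟨x, hx⟩
  have hf := tightMatrix_forces hmn i _ _
    (fun i' hi' => ⟨by funext; simp [bumpedMatrix, hi'], rfl⟩) x hx
  have hi := hx i
  simp only [bumpedMatrix, tightRhs] at hi
  push_cast at hi
  simp only [true_and, add_mul, Finset.sum_add_distrib, ite_mul, one_mul, zero_mul,
    Finset.sum_ite_eq', Finset.mem_univ, if_true] at hi
  by_cases h₁ : ∃ k : Fin n, (i : ℕ) = k
  · obtain ⟨k, hk⟩ := h₁
    have hv : ∀ k' : Fin n, (tightMatrix m n i k' : ℝ) = if k' = k then 1 else 0 := by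
      intro k'
      have : (k : ℕ) ≠ n + k' := by omega
      simp [tightMatrix, hk, this, Fin.ext_iff, eq_comm]
    have h1 : ∀ k', 1 ≤ x k' := fun k' => (hf k').2 (by omega)
    simp [hv] at hi
    linarith [h1 k, h1 j]
  by_cases h₂ : ∃ k : Fin n, (i : ℕ) = n + k
  · obtain ⟨k, hk⟩ := h₂
    have hv : ∀ k' : Fin n, (tightMatrix m n i k' : ℝ) = if k' = k then -1 else 0 := by
      intro k'
      have : n + (k : ℕ) ≠ k' := by omega
      simp [tightMatrix, hk, this, Fin.ext_iff, eq_comm]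
    have h1 : ∀ k', x k' ≤ 1 := fun k' => (hf k').1 (by omega)
    simp [hv] at hi
    by_cases hjk : j = k
    · subst hjk
      linarith
    · have : 1 ≤ x j := (hf j).2 (fun h => hjk (by ext; omega))
      linarith [h1 k]
  · push Not at h₁ h₂
    have h1 : ∀ k', x k' = 1 := fun k' =>
      le_antisymm ((hf k').1 (h₁ k')) ((hf k').2 (h₂ k'))
    simp [h1] at hi
    linarith

/-- The inequality opposite to row `i` survives and keeps the left-hand side of row `i` at or above
its old bound. -/
theorem not_feasible_update_rhs {m n : ℕ} (hmn : 2 * n ≤ m) (i : Fin m) :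
    ¬ LPFeasible (tightMatrix m n) (bumpedRhs m n i) := by
  rintro ⟨x, hx⟩
  have hf := tightMatrix_forces hmn i _ _ (fun i' hi' => ⟨rfl, by simp [bumpedRhs, hi']⟩) x hx
  have hi := hx i
  simp only [bumpedRhs, tightRhs] at hi
  push_cast at hi
  have : ∑ j, (tightMatrix m n i j : ℝ) ≤ ∑ j, (tightMatrix m n i j : ℝ) * x j := by
    refine Finset.sum_le_sum fun j _ => ?_
    unfold tightMatrix
    split_ifs with h₁ h₂
    · simpa using (hf j).2 (by omega)
    · simpa using (hf j).1 h₁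
    · simp
  linarith

/-- Adversary argument: the run on the tight instance reads all `m * n + m` input cells, and a run
of `t` steps reads at most `t` cells. -/
theorem IsLPSolver.le_runtime {S : RAM.Prog} {g : ℕ → ℕ → ℕ} (hS : IsLPSolver S g) {m n : ℕ}
    (hmn : 2 * n ≤ m) : m * n + m ≤ g n m := by
  obtain ⟨t, σ, he, ht, hσ⟩ := hS n m (tightMatrix m n) (tightRhs m n)
  have h1 := hσ.2 (tightMatrix_feasible m n)
  obtain ⟨R, hR, h⟩ := he.exists_reads
  -- Were this cell never read, the solver would also answer "feasible" after the entry is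
  -- increased.
  have hA : ∀ (i : Fin m) (j : Fin n), ((0, (i : ℕ) * n + (j : ℕ)) : ℕ × ℤ) ∈ R := by
    intro i j
    by_contra hc
    obtain ⟨τ, e, hr, -⟩ := h (lpInput (bumpedMatrix m n i j) (tightRhs m n))
      (by rw [lpInput_regs, lpInput_regs]) (by
        rintro ⟨a, z⟩ haz
        rcases a with _ | _ | a
        · have hz : z ≠ (i : ℕ) * n + (j : ℕ) := by rintro rfl; exact hc haz
          simp only [lpInput_arrs_zero, RAM.ofMatrix]
          refine Finset.sum_congr rfl fun i' _ => Finset.sum_congr rfl fun j' _ => ?_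
          by_cases hij : i' = i ∧ j' = j
          · obtain ⟨rfl, rfl⟩ := hij
            simp [hz]
          · simp [bumpedMatrix, hij]
        · simp only [zero_add, lpInput_arrs_one]
        · simp only [add_assoc, Nat.reduceAdd, lpInput_arrs_add_two])
    exact not_feasible_update_matrix hmn i j
      ((hS.regs_eq_one_iff e).1 (by rw [hr, h1]))
  have hb : ∀ i : Fin m, ((1, ((i : ℕ) : ℤ)) : ℕ × ℤ) ∈ R := by
    intro i
    by_contra hc
    obtain ⟨τ, e, hr, -⟩ := h (lpInput (tightMatrix m n) (bumpedRhs m n i))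
      (by rw [lpInput_regs, lpInput_regs]) (by
        rintro ⟨a, z⟩ haz
        rcases a with _ | _ | a
        · simp only [lpInput_arrs_zero]
        · have hz : z ≠ (i : ℕ) := by rintro rfl; exact hc haz
          simp only [zero_add, lpInput_arrs_one, RAM.ofVec]
          refine Finset.sum_congr rfl fun i' _ => ?_
          by_cases hij : i' = i
          · subst hij
            simp [hz]
          · simp [bumpedRhs, hij]
        · simp only [add_assoc, Nat.reduceAdd, lpInput_arrs_add_two])
    exact not_feasible_update_rhs hmn i
      ((hS.regs_eq_one_iff e).1 (by rw [hr, h1]))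
  -- Distinct matrix and right-hand side entries occupy distinct cells, which turns membership in
  -- `R` into a count.
  let f : (Fin m × Fin n) ⊕ Fin m → ℕ × ℤ :=
    Sum.elim (fun q => (0, (q.1 : ℕ) * n + (q.2 : ℕ))) fun i => (1, ((i : ℕ) : ℤ))
  have hinj : Function.Injective f := by
    rintro (⟨i, j⟩ | i) (⟨i', j'⟩ | i') hq
    · have hn : 0 < n := j.pos
      have hq' : (i : ℕ) * n + (j : ℕ) = (i' : ℕ) * n + (j' : ℕ) := by
        have := (Prod.ext_iff.1 hq).2
        simp only [f, Sum.elim_inl] at this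
        exact_mod_cast this
      have h1 : (i : ℕ) = i' := by
        have := congrArg (· / n) hq'
        simpa [Nat.add_div_of_dvd_right, Nat.div_eq_of_lt, hn] using this
      have h2 : (j : ℕ) = j' := by rw [h1] at hq'; omega
      rw [Fin.ext h1, Fin.ext h2]
    · simp [f] at hq
    · simp [f] at hq
    · have := (Prod.ext_iff.1 hq).2
      simp only [f, Sum.elim_inr, Nat.cast_inj] at this
      rw [Fin.ext this]
  have := Finset.card_le_card_of_injOn (s := Finset.univ) (t := R) f (by
    rintro (⟨i, j⟩ | i) -
    · exact hA i j
    · exact hb i) hinj.injOn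
  simp only [Finset.card_univ, Fintype.card_sum, Fintype.card_prod, Fintype.card_fin] at this
  omega

namespace RAM

/-! ### Simulation of a program inside a single array, with a log of the cells written

The memory of the simulated program is kept in the array `6`; for a bound `B` on the arrays that
the program mentions, its register `x` is the cell `(B + 1) * x`, and the cell `z` of its array `a`
is the cell `(B + 1) * z + (a + 1)`. The array `7` lists the cells of the array `6` that have been
written, and the register `6` holds the length of this list. -/

/-- A number larger than all arrays mentioned in the expression. -/
def Expr.arrBound : Expr → ℕ
  | .const _ => 0
  | .reg _ => 0
  | .get a i => max (a + 1) i.arrBound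
  | .add e₁ e₂ => max e₁.arrBound e₂.arrBound
  | .sub e₁ e₂ => max e₁.arrBound e₂.arrBound
  | .mul e₁ e₂ => max e₁.arrBound e₂.arrBound
  | .div e₁ e₂ => max e₁.arrBound e₂.arrBound

/-- A number larger than all arrays mentioned in the program. -/
def Prog.arrBound : Prog → ℕ
  | .skip => 0
  | .assign _ e => e.arrBound
  | .store a i e => max (a + 1) (max i.arrBound e.arrBound)
  | .seq p q => max p.arrBound q.arrBound
  | .cond e₁ e₂ p q => max (max e₁.arrBound e₂.arrBound) (max p.arrBound q.arrBound)
  | .loop e₁ e₂ p => max (max e₁.arrBound e₂.arrBound) p.arrBound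

/-- The address expression for the cell `i` of the simulated array `a`. -/
def cellAddr (B a : ℕ) (i : Expr) : Expr :=
  .add (.mul (.const ((B : ℤ) + 1)) i) (.const ((a : ℤ) + 1))

/-- The address expression for the simulated register `x`. -/
def regAddr (B x : ℕ) : Expr := .const (((B : ℤ) + 1) * x)

/-- Write into the array `6` and record the address in the log. -/
def logStore (i e : Expr) : Prog :=
  .seq (.store 7 (.reg 6) i) (.seq (.assign 6 (.add (.reg 6) (.const 1))) (.store 6 i e))

/-- Translation of expressions to the simulated memory. -/
def Expr.translate (B : ℕ) : Expr → Expr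
  | .const z => .const z
  | .reg x => .get 6 (regAddr B x)
  | .get a i => .get 6 (cellAddr B a (i.translate B))
  | .add e₁ e₂ => .add (e₁.translate B) (e₂.translate B)
  | .sub e₁ e₂ => .sub (e₁.translate B) (e₂.translate B)
  | .mul e₁ e₂ => .mul (e₁.translate B) (e₂.translate B)
  | .div e₁ e₂ => .div (e₁.translate B) (e₂.translate B)

/-- Translation of programs to the simulated memory. -/
def Prog.translate (B : ℕ) : Prog → Prog
  | .skip => .skip
  | .assign x e => logStore (regAddr B x) (e.translate B)
  | .store a i e => logStore (cellAddr B a (i.translate B)) (e.translate B)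
  | .seq p q => .seq (p.translate B) (q.translate B)
  | .cond e₁ e₂ p q =>
    .cond (e₁.translate B) (e₂.translate B) (p.translate B) (q.translate B)
  | .loop e₁ e₂ p => .loop (e₁.translate B) (e₂.translate B) (p.translate B)

/-- The expression refers neither to the log nor to its length. -/
def Expr.LogFree : Expr → Prop
  | .const _ => True
  | .reg x => x ≠ 6
  | .get a i => a ≠ 7 ∧ i.LogFree
  | .add e₁ e₂ => e₁.LogFree ∧ e₂.LogFree
  | .sub e₁ e₂ => e₁.LogFree ∧ e₂.LogFree
  | .mul e₁ e₂ => e₁.LogFree ∧ e₂.LogFree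
  | .div e₁ e₂ => e₁.LogFree ∧ e₂.LogFree

/-- `logStore` evaluates the address and the value after the log has been updated; this guarantees
that they have not changed. -/
theorem Expr.LogFree.val_eq {e : Expr} (h : e.LogFree) (τ : State) (i u v : ℤ) :
    e.val ((τ.setArr 7 i u).setReg 6 v) = e.val τ := by
  induction e with
  | const => rfl
  | reg x => simp [val, show x ≠ 6 from h]
  | get a i ih =>
    simp only [val, ih h.2, State.setReg_arrs, State.setArr_arrs_of_ne _ _ _ h.1]
  | add e₁ e₂ h₁ h₂ | sub e₁ e₂ h₁ h₂ | mul e₁ e₂ h₁ h₂ | div e₁ e₂ h₁ h₂ =>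
    simp only [val, h₁ h.1, h₂ h.2]

theorem Expr.logFree_translate (B : ℕ) (e : Expr) : (e.translate B).LogFree := by
  induction e with
  | const => trivial
  | reg x => exact ⟨by decide, trivial⟩
  | get a i ih => exact ⟨by decide, ⟨trivial, ih⟩, trivial⟩
  | add e₁ e₂ h₁ h₂ | sub e₁ e₂ h₁ h₂ | mul e₁ e₂ h₁ h₂ | div e₁ e₂ h₁ h₂ => exact ⟨h₁, h₂⟩

theorem Expr.cost_translate_le (B : ℕ) (e : Expr) : (e.translate B).cost ≤ 5 * e.cost := by
  induction e with
  | const | reg => simp [translate, cost, regAddr]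
  | get a i ih => simp only [translate, cost, cellAddr]; omega
  | add e₁ e₂ h₁ h₂ | sub e₁ e₂ h₁ h₂ | mul e₁ e₂ h₁ h₂ | div e₁ e₂ h₁ h₂ =>
    simp only [translate, cost]; omega

/-- The array `6` of `τ` is zero outside the cells listed in the log, whose length is `k`. -/
structure Logged (k : ℕ) (τ : State) : Prop where
  count : τ.regs 6 = k
  mem : ∀ w, τ.arrs 6 w ≠ 0 → ∃ l : ℕ, l < k ∧ τ.arrs 7 l = w

/-- The array `6` of `τ` represents the state `σ`, up to arrays from `B` on. -/
structure Represents (B : ℕ) (σ τ : State) : Prop where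
  regs : ∀ x : ℕ, τ.arrs 6 (((B : ℤ) + 1) * x) = σ.regs x
  arrs : ∀ a < B, ∀ z : ℤ, τ.arrs 6 (((B : ℤ) + 1) * z + (a + 1)) = σ.arrs a z

theorem Expr.val_translate {B : ℕ} {σ τ : State} (h : Represents B σ τ) (e : Expr)
    (hB : e.arrBound ≤ B) : (e.translate B).val τ = e.val σ := by
  induction e with
  | const => rfl
  | reg x => exact h.regs x
  | get a i ih =>
    simp only [arrBound, max_le_iff] at hB
    simp only [translate, val, cellAddr, ih hB.2]
    exact h.arrs a hB.1 _
  | add e₁ e₂ h₁ h₂ | sub e₁ e₂ h₁ h₂ | mul e₁ e₂ h₁ h₂ | div e₁ e₂ h₁ h₂ =>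
    simp only [arrBound, max_le_iff] at hB
    simp only [translate, val, h₁ hB.1, h₂ hB.2]

/-- Uniqueness of division with remainder. It separates the residue classes modulo `B + 1` that hold
the simulated registers and arrays, and also the entries of a matrix stored row by row. -/
theorem eq_of_mul_add_eq {K z z' u v : ℤ} (hu : 0 ≤ u) (hu' : u < K) (hv : 0 ≤ v) (hv' : v < K)
    (h : K * z + u = K * z' + v) : z = z' ∧ u = v := by
  have hK : K ≠ 0 := by omega
  have h₁ := congrArg (· / K) h
  simp only [Int.mul_add_ediv_left _ _ hK, Int.ediv_eq_zero_of_lt hu hu',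
    Int.ediv_eq_zero_of_lt hv hv', add_zero] at h₁
  subst h₁
  exact ⟨rfl, by linarith⟩

theorem Represents.setArr {B : ℕ} {σ τ τ' : State} (h : Represents B σ τ) {a : ℕ} (ha : a < B)
    (z v : ℤ)
    (hτ : ∀ w, τ'.arrs 6 w = if w = ((B : ℤ) + 1) * z + (a + 1) then v else τ.arrs 6 w) :
    Represents B (σ.setArr a z v) τ' := by
  constructor
  · intro x
    rw [hτ, if_neg, h.regs]
    · rfl
    · intro h'
      have := (eq_of_mul_add_eq (u := 0) le_rfl (by omega) (by omega) (by omega)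
        ((add_zero _).trans h')).2
      omega
  · intro a' ha' z'
    rw [hτ, h.arrs a' ha', State.setArr_arrs]
    refine if_congr ⟨fun h' => ?_, ?_⟩ rfl rfl
    · have := eq_of_mul_add_eq (by omega) (by omega) (by omega) (by omega) h'
      exact ⟨by omega, this.1⟩
    · rintro ⟨rfl, rfl⟩; rfl

theorem Represents.setReg {B : ℕ} {σ τ τ' : State} (h : Represents B σ τ) (x : ℕ) (v : ℤ)
    (hτ : ∀ w, τ'.arrs 6 w = if w = ((B : ℤ) + 1) * x then v else τ.arrs 6 w) :
    Represents B (σ.setReg x v) τ' := by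
  constructor
  · intro y
    rw [hτ, h.regs, State.setReg_regs]
    refine if_congr ⟨fun h' => ?_, ?_⟩ rfl rfl
    · have := mul_left_cancel₀ (by omega) h'
      exact_mod_cast this
    · rintro rfl; rfl
  · intro a ha z
    rw [hτ, if_neg, h.arrs a ha]
    · rfl
    · intro h'
      have := (eq_of_mul_add_eq (v := 0) (by omega) (by omega) le_rfl (by omega)
        (h'.trans (add_zero _).symm)).2
      omega

theorem exec_logStore {τ : State} {k : ℕ} (h : Logged k τ) {i e : Expr} (hi : i.LogFree)
    (he : e.LogFree) : ∃ τ' : State,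
      Exec (logStore i e) τ (2 * i.cost + e.cost + 7) τ' ∧ Logged (k + 1) τ' ∧
      ∀ w, τ'.arrs 6 w = if w = i.val τ then e.val τ else τ.arrs 6 w := by
  have e₁ := Exec.store τ 7 (.reg 6) i
  have e₂ := Exec.assign (τ.setArr 7 ((Expr.reg 6).val τ) (i.val τ)) 6
    (.add (.reg 6) (.const 1))
  have e₃ := Exec.store ((τ.setArr 7 ((Expr.reg 6).val τ) (i.val τ)).setReg 6
    ((Expr.add (.reg 6) (.const 1)).val (τ.setArr 7 ((Expr.reg 6).val τ) (i.val τ)))) 6 i e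
  rw [hi.val_eq, he.val_eq] at e₃
  have e₄ := Exec.seq _ _ _ _ _ _ _ e₁ (Exec.seq _ _ _ _ _ _ _ e₂ e₃)
  have hval : ∀ w, (((τ.setArr 7 ((Expr.reg 6).val τ) (i.val τ)).setReg 6
      ((Expr.add (.reg 6) (.const 1)).val
        (τ.setArr 7 ((Expr.reg 6).val τ) (i.val τ)))).setArr 6 (i.val τ) (e.val τ)).arrs 6 w =
      if w = i.val τ then e.val τ else τ.arrs 6 w := by
    intro w
    simp [State.setArr_arrs]
  refine ⟨_, ?_, ⟨?_, fun w hw => ?_⟩, hval⟩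
  -- The address is evaluated twice, once for the log and once for the write itself.
  · have ht : 2 * i.cost + e.cost + 7 = (Expr.reg 6).cost + i.cost + 1 +
        ((Expr.add (.reg 6) (.const 1)).cost + 1 + (i.cost + e.cost + 1)) := by
      simp only [Expr.cost]; ring
    rw [ht]
    exact e₄
  · simp [Expr.val, h.count]
  · rw [hval] at hw
    simp only [State.setArr_arrs, State.setReg_arrs, Expr.val, h.count]
    split_ifs at hw with hwi
    · exact ⟨k, by omega, by simp [hwi]⟩
    · obtain ⟨l, hl, hlw⟩ := h.mem w hw
      exact ⟨l, by omega, by simp [hl.ne, hlw]⟩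

/-- A program is simulated by its translation with constant overhead. -/
theorem Exec.translate {B : ℕ} {p : Prog} {σ σ' : State} {t : ℕ} (h : Exec p σ t σ')
    (hB : p.arrBound ≤ B) : ∀ (τ : State) (k : ℕ), Represents B σ τ → Logged k τ →
      ∃ (t' k' : ℕ) (τ' : State), Exec (p.translate B) τ t' τ' ∧ t' ≤ 16 * t ∧ k' ≤ k + t ∧
        Represents B σ' τ' ∧ Logged k' τ' := by
  induction h with
  | skip σ => intro τ k hr hl; exact ⟨1, k, τ, .skip τ, by omega, by omega, hr, hl⟩
  | assign σ x e =>
    intro τ k hr hl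
    obtain ⟨τ', he, hl', hv⟩ := exec_logStore hl (i := regAddr B x) trivial
      (e.logFree_translate B)
    refine ⟨_, _, τ', he, ?_, by omega, ?_, hl'⟩
    · have := e.cost_translate_le B
      simp only [regAddr, Expr.cost]; omega
    · rw [Expr.val_translate hr e hB] at hv
      exact hr.setReg x _ hv
  | store σ a i e =>
    intro τ k hr hl
    simp only [Prog.arrBound, max_le_iff] at hB
    obtain ⟨τ', he, hl', hv⟩ := exec_logStore hl (i := cellAddr B a (i.translate B))
      ⟨⟨trivial, i.logFree_translate B⟩, trivial⟩ (e.logFree_translate B)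
    -- The constant 16 comes from this case: the address costs at most `5 * i.cost + 4` and is
    -- evaluated twice, so the total is at most `10 * i.cost + 5 * e.cost + 15`. One log entry is
    -- added per store, which costs at least one step.
    refine ⟨_, _, τ', he, ?_, by omega, ?_, hl'⟩
    · have := e.cost_translate_le B
      have := i.cost_translate_le B
      simp only [cellAddr, Expr.cost]; omega
    · rw [Expr.val_translate hr e hB.2.2] at hv
      simp only [cellAddr, Expr.val, Expr.val_translate hr i hB.2.1] at hv
      exact hr.setArr hB.1 _ _ hv
  | seq p q σ₁ σ₂ σ₃ t₁ t₂ _ _ ih₁ ih₂ =>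
    intro τ k hr hl
    simp only [Prog.arrBound, max_le_iff] at hB
    obtain ⟨s₁, k₁, τ₁, e₁, hs₁, hk₁, hr₁, hl₁⟩ := ih₁ hB.1 τ k hr hl
    obtain ⟨s₂, k₂, τ₂, e₂, hs₂, hk₂, hr₂, hl₂⟩ := ih₂ hB.2 τ₁ k₁ hr₁ hl₁
    exact ⟨_, k₂, τ₂, .seq _ _ _ _ _ _ _ e₁ e₂, by omega, by omega, hr₂, hl₂⟩
  | condTrue e₁ e₂ p q σ σ' t hc _ ih =>
    intro τ k hr hl
    simp only [Prog.arrBound, max_le_iff] at hB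
    obtain ⟨s, k', τ', e, hs, hk', hr', hl'⟩ := ih hB.2.1 τ k hr hl
    refine ⟨_, k', τ', .condTrue _ _ _ _ _ _ _ ?_ e, ?_, by omega, hr', hl'⟩
    · rwa [Expr.val_translate hr e₁ hB.1.1, Expr.val_translate hr e₂ hB.1.2]
    · have := e₁.cost_translate_le B
      have := e₂.cost_translate_le B
      omega
  | condFalse e₁ e₂ p q σ σ' t hc _ ih =>
    intro τ k hr hl
    simp only [Prog.arrBound, max_le_iff] at hB
    obtain ⟨s, k', τ', e, hs, hk', hr', hl'⟩ := ih hB.2.2 τ k hr hl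
    refine ⟨_, k', τ', .condFalse _ _ _ _ _ _ _ ?_ e, ?_, by omega, hr', hl'⟩
    · rwa [Expr.val_translate hr e₁ hB.1.1, Expr.val_translate hr e₂ hB.1.2]
    · have := e₁.cost_translate_le B
      have := e₂.cost_translate_le B
      omega
  | loopDone e₁ e₂ p σ hc =>
    intro τ k hr hl
    simp only [Prog.arrBound, max_le_iff] at hB
    refine ⟨_, k, τ, .loopDone _ _ _ _ ?_, ?_, by omega, hr, hl⟩
    · rwa [Expr.val_translate hr e₁ hB.1.1, Expr.val_translate hr e₂ hB.1.2]
    · have := e₁.cost_translate_le B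
      have := e₂.cost_translate_le B
      omega
  | loopStep e₁ e₂ p σ₁ σ₂ σ₃ t₁ t₂ hc _ _ ih₁ ih₂ =>
    intro τ k hr hl
    have hB' := hB
    simp only [Prog.arrBound, max_le_iff] at hB
    obtain ⟨s₁, k₁, τ₁, g₁, hs₁, hk₁, hr₁, hl₁⟩ := ih₁ hB.2 τ k hr hl
    obtain ⟨s₂, k₂, τ₂, g₂, hs₂, hk₂, hr₂, hl₂⟩ := ih₂ hB' τ₁ k₁ hr₁ hl₁
    refine ⟨_, k₂, τ₂, .loopStep _ _ _ _ _ _ _ _ ?_ g₁ g₂, ?_, by omega, hr₂, hl₂⟩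
    · rwa [Expr.val_translate hr e₁ hB.1.1, Expr.val_translate hr e₂ hB.1.2]
    · have := e₁.cost_translate_le B
      have := e₂.cost_translate_le B
      omega

/-- Reset the cells of the array `6` listed in the log. -/
def clearLog : Prog :=
  .loop (.const 1) (.reg 6) (.seq (.assign 6 (.sub (.reg 6) (.const 1)))
    (.store 6 (.get 7 (.reg 6)) (.const 0)))

/-- Entries are popped from the end, at 11 steps each. A cell that is still nonzero after a pop
differs from the cell just cleared, so it is listed among the remaining entries. -/
theorem halts_clearLog {k : ℕ} : ∀ {τ : State}, Logged k τ →
    Halts clearLog τ (11 * k + 3) fun τ' => τ'.arrs 6 = 0 ∧ τ'.regs 6 = 0 := by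
  induction k with
  | zero =>
    intro τ h
    refine ⟨_, _, .loopDone _ _ _ _ ?_, by simp [Expr.cost], ?_, by simpa using h.count⟩
    · simp [Expr.val, h.count]
    · funext w
      by_contra hw
      obtain ⟨l, hl, -⟩ := h.mem w hw
      omega
  | succ k ih =>
    intro τ h
    have e₁ := Exec.assign τ 6 (.sub (.reg 6) (.const 1))
    have e₂ := Exec.store (τ.setReg 6 ((Expr.sub (.reg 6) (.const 1)).val τ)) 6
      (.get 7 (.reg 6)) (.const 0)
    have e₃ := Exec.seq _ _ _ _ _ _ _ e₁ e₂
    obtain ⟨t, τ', e, ht, hQ⟩ := ih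
      (τ := (τ.setReg 6 ((Expr.sub (.reg 6) (.const 1)).val τ)).setArr 6
      ((Expr.get 7 (.reg 6)).val (τ.setReg 6 ((Expr.sub (.reg 6) (.const 1)).val τ)))
      ((Expr.const 0).val (τ.setReg 6 ((Expr.sub (.reg 6) (.const 1)).val τ)))) (by
        constructor
        · simp [Expr.val, h.count]
        · intro w hw
          simp only [State.setArr_arrs_self, State.setReg_arrs, Expr.val, h.count,
            State.setReg_regs, if_true] at hw
          push_cast at hw
          rw [add_sub_cancel_right] at hw
          split_ifs at hw with hw'
          · exact absurd rfl hw
          · obtain ⟨l, hl, hlw⟩ := h.mem w hw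
            have : l ≠ k := by rintro rfl; exact hw' hlw.symm
            exact ⟨l, by omega, by simpa [State.setArr_arrs] using hlw⟩)
    refine ⟨_, _, .loopStep _ _ _ _ _ _ _ _ ?_ e₃ e, ?_, hQ⟩
    · simp only [Expr.val, h.count]; omega
    · simp only [Expr.cost]; omega

theorem Prog.eq_of_writesReg_translate {B x : ℕ} {p : Prog} (h : (p.translate B).WritesReg x) :
    x = 6 := by
  induction p with
  | skip => exact h.elim
  | assign | store => simpa [translate, logStore, WritesReg] using h
  | seq p q h₁ h₂ | cond _ _ p q h₁ h₂ => exact h.elim h₁ h₂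
  | loop _ _ p ih => exact ih h

theorem Prog.of_writesArr_translate {B a : ℕ} {p : Prog} (h : (p.translate B).WritesArr a) :
    a = 6 ∨ a = 7 := by
  induction p with
  | skip => exact h.elim
  | assign | store =>
    simp only [translate, logStore, WritesArr] at h
    tauto
  | seq p q h₁ h₂ | cond _ _ p q h₁ h₂ => exact h.elim h₁ h₂
  | loop _ _ p ih => exact ih h

end RAM

/-! ### Integrality of polytopes with totally unimodular constraint matrices -/

open Matrix in
/-- If the kernel of a real matrix is trivial, some of its rows form an invertible square matrix. -/
theorem Matrix.exists_isUnit_submatrix {ι ν : Type} [Fintype ι] [Fintype ν] [DecidableEq ν]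
    (A : Matrix ι ν ℝ) (hA : ∀ z : ν → ℝ, A *ᵥ z = 0 → z = 0) :
    ∃ f : ν → ι, IsUnit (A.submatrix f id) := by
  have hinj : Function.Injective A.mulVecLin := by
    rw [← LinearMap.ker_eq_bot, LinearMap.ker_eq_bot']
    exact fun z hz => hA z (by simpa using hz)
  -- Row rank equals column rank, and the latter is full by injectivity. A basis of the row space
  -- chosen among the rows then has as many members as there are columns.
  have hrank : Module.finrank ℝ (Submodule.span ℝ (Set.range A.row)) = Fintype.card ν := by
    rw [← A.rank_eq_finrank_span_row, Matrix.rank, LinearMap.finrank_range_of_inj hinj,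
      Module.finrank_fintype_fun_eq_card]
  obtain ⟨κ, a, ha, hspan, hli⟩ := exists_linearIndependent' ℝ A.row
  have : Finite κ := Finite.of_injective a ha
  have := Fintype.ofFinite κ
  have hcard := linearIndependent_iff_card_eq_finrank_span.1 hli
  rw [Set.finrank, hspan, hrank] at hcard
  let e : ν ≃ κ := Fintype.equivOfCardEq hcard.symm
  exact ⟨a ∘ e, Matrix.linearIndependent_rows_iff_isUnit.1 (hli.comp e e.injective)⟩

open Matrix Filter Topology in
/-- At an extreme point of a polyhedron, only the zero vector is orthogonal to all rows of tight
constraints. -/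
theorem eq_zero_of_mem_extremePoints {ι ν : Type} [Fintype ι] [Fintype ν]
    {A : Matrix ι ν ℝ} {b : ι → ℝ} {y : ν → ℝ}
    (hy : y ∈ Set.extremePoints ℝ {y | ∀ i, (A *ᵥ y) i ≤ b i}) {z : ν → ℝ}
    (hz : ∀ i, (A *ᵥ y) i = b i → (A *ᵥ z) i = 0) : z = 0 := by
  have hyP : ∀ i, (A *ᵥ y) i ≤ b i := hy.1
  -- Moving by `ε • z` in either direction keeps tight rows tight, and slack rows satisfied for
  -- small `ε`. Then `y` is the midpoint of two points of the polyhedron, which forces `ε • z = 0`.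
  have key : ∀ i, ∀ᶠ ε : ℝ in 𝓝[>] 0,
      (A *ᵥ (y + ε • z)) i ≤ b i ∧ (A *ᵥ (y - ε • z)) i ≤ b i := by
    intro i
    simp only [mulVec_add, mulVec_sub, mulVec_smul, Pi.add_apply, Pi.sub_apply, Pi.smul_apply,
      smul_eq_mul]
    rcases (hyP i).eq_or_lt with h | h
    · simp [hz i h, h]
    · refine Filter.Eventually.filter_mono nhdsWithin_le_nhds (Filter.Eventually.and ?_ ?_)
      · refine Filter.Eventually.mono (ContinuousAt.eventually_lt (f := fun ε : ℝ =>
          (A *ᵥ y) i + ε * (A *ᵥ z) i) (g := fun _ => b i) ?_ ?_ ?_) fun _ h => h.le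
        · fun_prop
        · fun_prop
        · simpa using h
      · refine Filter.Eventually.mono (ContinuousAt.eventually_lt (f := fun ε : ℝ =>
          (A *ᵥ y) i - ε * (A *ᵥ z) i) (g := fun _ => b i) ?_ ?_ ?_) fun _ h => h.le
        · fun_prop
        · fun_prop
        · simpa using h
  obtain ⟨ε, hε, hε0⟩ := ((eventually_all.2 key).and self_mem_nhdsWithin).exists
  have hε0 : (0 : ℝ) < ε := hε0
  have h := hy.2 (show y + ε • z ∈ {y | ∀ i, (A *ᵥ y) i ≤ b i} from fun i => (hε i).1)
    (show y - ε • z ∈ {y | ∀ i, (A *ᵥ y) i ≤ b i} from fun i => (hε i).2)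
    ⟨1 / 2, 1 / 2, by norm_num, by norm_num, by norm_num, by module⟩
  have : ε • z = 0 := by simpa using h
  exact (smul_eq_zero.1 this).resolve_left hε0.ne'

open Matrix in
/-- A nonempty bounded polyhedron with a totally unimodular constraint matrix and integral
right-hand side contains an integral point. -/
theorem Matrix.IsTotallyUnimodular.exists_int {ι ν : Type} [Fintype ι] [Fintype ν]
    {A : Matrix ι ν ℤ} (hA : A.IsTotallyUnimodular) (b : ι → ℤ) (K : ℝ)
    (hK : ∀ y : ν → ℝ, (∀ i, ∑ j, (A i j : ℝ) * y j ≤ b i) → ∀ j, |y j| ≤ K)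
    (hne : ∃ y : ν → ℝ, ∀ i, ∑ j, (A i j : ℝ) * y j ≤ b i) :
    ∃ x : ν → ℤ, ∀ i, ∑ j, A i j * x j ≤ b i := by
  classical
  let A' : Matrix ι ν ℝ := A.map (Int.cast : ℤ → ℝ)
  let P : Set (ν → ℝ) := {y | ∀ i, (A' *ᵥ y) i ≤ (b i : ℝ)}
  have hP : ∀ y, y ∈ P ↔ ∀ i, ∑ j, (A i j : ℝ) * y j ≤ b i := fun y => Iff.rfl
  have hcl : IsClosed P := by
    simp only [P, Set.ofPred_forall]
    refine isClosed_iInter fun i => isClosed_le ?_ continuous_const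
    simp only [mulVec, dotProduct]
    fun_prop
  have hbd : Bornology.IsBounded P := by
    refine (Metric.isBounded_closedBall (x := (0 : ν → ℝ)) (r := |K|)).subset fun y hy => ?_
    rw [mem_closedBall_zero_iff]
    refine (pi_norm_le_iff_of_nonneg (abs_nonneg K)).2 fun j => ?_
    exact (hK y ((hP y).1 hy) j).trans (le_abs_self K)
  obtain ⟨y, hy⟩ := (Metric.isCompact_of_isClosed_isBounded hcl hbd).extremePoints_nonempty
    (by obtain ⟨y, hy⟩ := hne; exact ⟨y, (hP y).2 hy⟩)
  let T := {i : ι // (A' *ᵥ y) i = (b i : ℝ)}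
  obtain ⟨f, hf⟩ := Matrix.exists_isUnit_submatrix (A'.submatrix (Subtype.val : T → ι) id)
    fun z hz => eq_zero_of_mem_extremePoints hy fun i hi => congrFun hz ⟨i, hi⟩
  let B : Matrix ν ν ℤ := A.submatrix (fun j => (f j).1) id
  have hB : (A'.submatrix (Subtype.val : T → ι) id).submatrix f id =
      B.map (Int.cast : ℤ → ℝ) := rfl
  rw [hB] at hf
  -- Total unimodularity leaves only `-1, 0, 1` for the determinant, and `0` is excluded by
  -- invertibility over the reals.
  have hdet : IsUnit B.det := by
    have h₁ : B.det ∈ Set.range SignType.cast :=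
      (isTotallyUnimodular_iff_fintype A).1 hA ν (fun j => (f j).1) id
    have h₂ : B.det ≠ 0 := by
      intro h
      have := (Matrix.isUnit_iff_isUnit_det _).1 hf
      have e : (B.map (Int.cast : ℤ → ℝ)).det = ((B.det : ℤ) : ℝ) :=
        ((Int.castRingHom ℝ).map_det B).symm
      rw [e, h] at this
      simp at this
    obtain ⟨s, hs⟩ := h₁
    rw [← hs] at h₂ ⊢
    cases s <;> simp at h₂ ⊢
  let x : ν → ℤ := B⁻¹ *ᵥ fun j => b (f j).1
  have hx : B *ᵥ x = fun j => b (f j).1 := by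
    simp [x, mulVec_mulVec, Matrix.mul_nonsing_inv B hdet]
  -- Both vectors solve the tight subsystem, whose matrix is invertible, so the extreme point itself
  -- is integral.
  have hxy : (fun j => (x j : ℝ)) = y := by
    refine (Matrix.mulVec_injective_iff_isUnit.2 hf) ?_
    funext j
    have h₁ := congrArg (Int.cast : ℤ → ℝ) (congrFun hx j)
    have h₂ : (B.map (Int.cast : ℤ → ℝ) *ᵥ y) j = b (f j).1 := (f j).2
    rw [h₂, ← h₁]
    simp [mulVec, dotProduct]
  refine ⟨x, fun i => ?_⟩
  have := (hP y).1 hy.1 i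
  rw [← hxy] at this
  simp only at this
  exact_mod_cast this

/-! ### Fixing the boundary variables -/

namespace BoundariedILP

variable {r : ℕ}

/-- The constraint matrix with the columns of the boundary variables replaced by zero. -/
def fixedMatrix (I : BoundariedILP r) : Matrix (Fin I.m) (Fin I.n) ℤ := fun i j =>
  if ∃ k, I.t k = j then 0 else I.A i j

/-- The right-hand side after substituting `a` for the boundary variables. -/
def fixedRhs (I : BoundariedILP r) (a : Fin r → ℤ) : Fin I.m → ℤ := fun i =>
  I.b i - ∑ k, I.A i (I.t k) * a k

theorem sum_eq_inner_add_boundary {R : Type} [AddCommMonoid R] (I : BoundariedILP r)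
    (f : Fin I.n → R) :
    ∑ j, f j = ∑ j : {j : Fin I.n // j ∉ Set.range I.t}, f j + ∑ k, f (I.t k) := by
  classical
  rw [← Fintype.sum_subtype_add_sum_subtype (fun j => j ∈ Set.range I.t) f, add_comm]
  congr 1
  convert (Fintype.sum_equiv (Equiv.ofInjective I.t I.t.injective) (fun k => f (I.t k))
    (fun j : {j : Fin I.n // j ∈ Set.range I.t} => f j) fun _ => rfl).symm

theorem sum_fixedMatrix (I : BoundariedILP r) (i : Fin I.m) (y : Fin I.n → ℝ) :
    ∑ j, (I.fixedMatrix i j : ℝ) * y j =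
      ∑ j : {j : Fin I.n // j ∉ Set.range I.t}, (I.A i j : ℝ) * y j := by
  rw [I.sum_eq_inner_add_boundary]
  have h₁ : ∀ k, (I.fixedMatrix i (I.t k) : ℝ) * y (I.t k) = 0 := fun k => by
    simp [fixedMatrix]
  simp only [h₁, Finset.sum_const_zero, add_zero]
  refine Finset.sum_congr rfl fun j _ => ?_
  have : ¬ ∃ k, I.t k = j := j.2
  simp [fixedMatrix, this]

theorem HasDomainSize.bounds {I : BoundariedILP r} {d : ℕ} (h : I.HasDomainSize d)
    {x : Fin I.n → ℤ} (hx : ∀ i, ∑ j, I.A i j * x j ≤ I.b i) (j : Fin I.n) :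
    0 ≤ x j ∧ x j < d := by
  obtain ⟨⟨i, hi, d', hd', hb⟩, i₂, hi₂, d'', hd'', hb₂⟩ := h j
  have h₁ := hx i
  have h₂ := hx i₂
  rw [hi, hb] at h₁
  rw [hi₂, hb₂] at h₂
  simp [Pi.single_apply] at h₁ h₂
  omega

/-- The lower and upper domain constraints of the `n` variables have `2 * n` pairwise different
rows, namely the unit vectors and their negatives. -/
theorem HasDomainSize.two_mul_le {I : BoundariedILP r} {d : ℕ} (h : I.HasDomainSize d) :
    2 * I.n ≤ I.m := by
  choose h₁ h₂ using h
  choose f hf _ using h₁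
  choose g hg _ using h₂
  have hinj : Function.Injective (Sum.elim f g) := by
    have hs : ∀ j j' : Fin I.n, (Pi.single j 1 : Fin I.n → ℤ) = Pi.single j' 1 → j = j' := by
      intro j j' h
      by_contra hne
      have := congrFun h j
      simp [hne] at this
    have hns : ∀ j j' : Fin I.n, -(Pi.single j 1 : Fin I.n → ℤ) ≠ Pi.single j' 1 := by
      intro j j' h
      have := congrFun h j
      simp only [Pi.neg_apply, Pi.single_apply, if_true] at this
      split_ifs at this
    rintro (j | j) (j' | j') hjj
    · have := hf j
      simp only [Sum.elim_inl] at hjj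
      rw [hjj, hf j'] at this
      rw [hs _ _ (neg_injective this)]
    · simp only [Sum.elim_inl, Sum.elim_inr] at hjj
      have := hf j
      rw [hjj, hg j'] at this
      exact absurd this.symm (hns _ _)
    · simp only [Sum.elim_inl, Sum.elim_inr] at hjj
      have := hg j
      rw [hjj, hf j'] at this
      exact absurd this (hns _ _)
    · have := hg j
      simp only [Sum.elim_inr] at hjj
      rw [hjj, hg j'] at this
      rw [hs _ _ this]
  have := Fintype.card_le_of_injective _ hinj
  simp only [Fintype.card_sum, Fintype.card_fin] at this
  omega

theorem le_n (I : BoundariedILP r) : r ≤ I.n := by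
  simpa using Fintype.card_le_of_injective _ I.t.injective

/-- A boundary assignment is feasible if and only if the linear program that arises from it by
substitution is feasible. -/
theorem lpFeasible_fixed_iff {I : BoundariedILP r} {d : ℕ} (hI : I.HasDomainSize d)
    (hA : I.innerMatrix.IsTotallyUnimodular) (a : Fin r → ℤ) :
    LPFeasible I.fixedMatrix (I.fixedRhs a) ↔ a ∈ I.feasibleBoundary := by
  constructor
  · rintro ⟨y, hy⟩
    -- The domain constraints of inner variables have zero coefficients in the boundary columns, so
    -- they survive the substitution unchanged and bound the polyhedron.
    have hbound : ∀ y : {j : Fin I.n // j ∉ Set.range I.t} → ℝ,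
        (∀ i, ∑ j, (I.innerMatrix i j : ℝ) * y j ≤ I.fixedRhs a i) → ∀ j, |y j| ≤ d := by
      intro y hy j
      obtain ⟨⟨i, hi, d', hd', hb⟩, i₂, hi₂, d'', hd'', hb₂⟩ := hI j
      have hjt : ∀ k, I.t k ≠ j.1 := fun k hk => j.2 ⟨k, hk⟩
      have h₁ := hy i
      have h₂ := hy i₂
      have hsub : ∀ j' : {j : Fin I.n // j ∉ Set.range I.t}, (j' : Fin I.n) = j ↔ j' = j :=
        fun j' => Subtype.ext_iff.symm
      simp [innerMatrix, fixedRhs, hi, hb, Pi.single_apply, hjt, hsub] at h₁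
      simp [innerMatrix, fixedRhs, hi₂, hb₂, Pi.single_apply, hjt, hsub] at h₂
      have h₃ : (d'' : ℝ) ≤ (d : ℝ) - 1 := by exact_mod_cast hd''
      have h₄ : (0 : ℝ) ≤ d' := by exact_mod_cast hd'
      rw [abs_le]
      constructor <;> linarith
    obtain ⟨x, hx⟩ := hA.exists_int (I.fixedRhs a) d hbound
      ⟨fun j => y j, fun i => (I.sum_fixedMatrix i y).ge.trans (hy i)⟩
    let x' : Fin I.n → ℤ := fun j =>
      if h : j ∈ Set.range I.t then a (Classical.choose h) else x ⟨j, h⟩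
    have ht : ∀ k, x' (I.t k) = a k := fun k => by
      have h : I.t k ∈ Set.range I.t := ⟨k, rfl⟩
      simp only [x', dif_pos h]
      rw [I.t.injective (Classical.choose_spec h)]
    have hi : ∀ j : {j : Fin I.n // j ∉ Set.range I.t}, x' j = x j := fun j => by
      simp only [x', dif_neg j.2]
    refine ⟨x', fun i => ?_, ht⟩
    rw [I.sum_eq_inner_add_boundary]
    simp only [ht, hi]
    have := hx i
    simp only [fixedRhs, innerMatrix, Matrix.submatrix_apply, id] at this
    linarith
  · rintro ⟨x, hx, ht⟩
    refine ⟨fun j => x j, fun i => ?_⟩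
    rw [I.sum_fixedMatrix]
    have := hx i
    rw [I.sum_eq_inner_add_boundary] at this
    simp only [ht] at this
    have h : ∑ j : {j : Fin I.n // j ∉ Set.range I.t}, I.A i j * x j ≤ I.fixedRhs a i := by
      simp only [fixedRhs]; linarith
    exact_mod_cast h

end BoundariedILP

/-! ### The output system -/

/-- The digit of weight `d ^ k` of `c` in base `d`. -/
def digit (d k c : ℕ) : ℕ := c / d ^ k % d

theorem exists_digits {r d : ℕ} (a : Fin r → ℤ) (h : ∀ k, 0 ≤ a k ∧ a k < d) :
    ∃ c < d ^ r, ∀ k : Fin r, a k = digit d k c := by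
  let f : Fin r → Fin d := fun k => ⟨(a k).toNat, by have := h k; omega⟩
  refine ⟨finFunctionFinEquiv f, (finFunctionFinEquiv f).2, fun k => ?_⟩
  -- The inverse of `finFunctionFinEquiv` extracts base-`d` digits by the very formula of `digit`.
  have h₁ : (finFunctionFinEquiv.symm (finFunctionFinEquiv f) k : ℕ) =
      digit d k (finFunctionFinEquiv f) := rfl
  rw [← h₁, Equiv.symm_apply_apply]
  have := (h k).1
  simp only [f]
  omega

theorem digit_lt {d : ℕ} (hd : 1 ≤ d) (k c : ℕ) : digit d k c < d := Nat.mod_lt _ hd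

/-- The rows of the output matrix, up to sign. The first `r` columns belong to the boundary
variables, the column `j ≥ r` to the indicator of the assignment with the number `j + 1 - r`. The
rows below `N` are unit vectors, the following `r` rows express the boundary variables through the
indicators, and the last row is the sum of the indicators. -/
def outBase (N r d i j : ℕ) : ℤ :=
  if i < N then (if j = i then 1 else 0)
  else if i < N + r then
    (if j < r then (if j = i - N then 1 else 0) else -(digit d (i - N) (j + 1 - r) : ℤ))
  else if j < r then 0 else 1

/-- The output matrix: every row of `outBase`, followed by its negative. -/
def outEntry (N r d i j : ℕ) : ℤ := (1 - 2 * ((i % 2 : ℕ) : ℤ)) * outBase N r d (i / 2) j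

/-- The right-hand side of the output system, where `F` is the indicator function of the set of
feasible assignments. -/
def outRhs (N r d : ℕ) (F : ℕ → ℤ) (i : ℕ) : ℤ :=
  if i % 2 = 0 then
    if i / 2 < r then (d : ℤ) - 1
    else if i / 2 < N then F (i / 2 + 1 - r)
    else if i / 2 < N + r then 0 else 1
  else if i / 2 < N + r then 0 else F 0 - 1

/-- The number of variables of the output system. -/
def outVars (r d : ℕ) : ℕ := r + d ^ r - 1

theorem le_outVars {r d : ℕ} (hd : 1 ≤ d) : r ≤ outVars r d := by
  have := Nat.one_le_pow r d hd
  unfold outVars; omega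

/-- A boundaried integer linear program whose feasible boundary assignments are those with numbers
in the set with indicator function `F`. -/
def outILP (r d : ℕ) (hd : 1 ≤ d) (F : ℕ → ℤ) : BoundariedILP r where
  n := outVars r d
  m := 2 * (outVars r d + r + 1)
  A := fun i j => outEntry (outVars r d) r d i j
  b := fun i => outRhs (outVars r d) r d F i
  t := Fin.castLEEmb (le_outVars hd)

/-- Rows `2 * i` and `2 * i + 1` bound the same linear form from above and below. For the middle `r`
forms both bounds are `0`, which yields the equations for the boundary variables. -/
theorem outILP_feasible_iff {r d : ℕ} (hd : 1 ≤ d) (F : ℕ → ℤ) (x : Fin (outVars r d) → ℤ) :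
    (∀ i : Fin (outILP r d hd F).m,
      ∑ j : Fin (outVars r d), (outILP r d hd F).A i j * x j ≤ (outILP r d hd F).b i) ↔
    (∀ j, 0 ≤ x j ∧ x j ≤ if (j : ℕ) < r then (d : ℤ) - 1 else F (j + 1 - r)) ∧
    (∀ k : Fin r, x (Fin.castLE (le_outVars hd) k) =
      ∑ j : Fin (outVars r d), if (j : ℕ) < r then 0 else (digit d k (j + 1 - r) : ℤ) * x j) ∧
    (1 - F 0 ≤ ∑ j : Fin (outVars r d), if (j : ℕ) < r then 0 else x j) ∧
    ∑ j : Fin (outVars r d), (if (j : ℕ) < r then 0 else x j) ≤ 1 := by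
  have hr : r ≤ (outVars r d) := le_outVars hd
  have e₁ : (∀ i : Fin (outILP r d hd F).m,
      ∑ j : Fin (outVars r d), (outILP r d hd F).A i j * x j ≤ (outILP r d hd F).b i) ↔
      ∀ i : ℕ, i < outVars r d + r + 1 →
        (∑ j : Fin (outVars r d), outBase (outVars r d) r d i j * x j ≤
          outRhs (outVars r d) r d F (2 * i)) ∧
        -∑ j : Fin (outVars r d), outBase (outVars r d) r d i j * x j ≤
          outRhs (outVars r d) r d F (2 * i + 1) := by
    have hA : ∀ (i : Fin (outILP r d hd F).m) (j : Fin (outVars r d)),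
        (outILP r d hd F).A i j = outEntry (outVars r d) r d i j := fun _ _ => rfl
    have hb : ∀ i : Fin (outILP r d hd F).m,
        (outILP r d hd F).b i = outRhs (outVars r d) r d F i :=
      fun _ => rfl
    have hev : ∀ (i : ℕ) (j : Fin (outVars r d)),
        outEntry (outVars r d) r d (2 * i) j = outBase (outVars r d) r d i j := by
      intro i j; simp [outEntry]
    have hod : ∀ (i : ℕ) (j : Fin (outVars r d)),
        outEntry (outVars r d) r d (2 * i + 1) j = -outBase (outVars r d) r d i j := by
      intro i j
      have h₁ : (2 * i + 1) % 2 = 1 := by omega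
      have h₂ : (2 * i + 1) / 2 = i := by omega
      simp [outEntry, h₁, h₂]
    simp only [hA, hb]
    constructor
    · intro h i hi
      have h₁ := h ⟨2 * i, by simp only [outILP]; omega⟩
      have h₂ := h ⟨2 * i + 1, by simp only [outILP]; omega⟩
      simp only [hev] at h₁
      simp only [hod, neg_mul, Finset.sum_neg_distrib] at h₂
      exact ⟨h₁, h₂⟩
    · rintro h ⟨i, hi⟩
      simp only [outILP] at hi
      obtain ⟨h₁, h₂⟩ := h (i / 2) (by omega)
      rcases Nat.mod_two_eq_zero_or_one i with h' | h'
      · have e : i = 2 * (i / 2) := by omega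
        simp only
        rw [e]
        simpa only [hev] using h₁
      · have e : i = 2 * (i / 2) + 1 := by omega
        simp only
        rw [e]
        simpa only [hod, neg_mul, Finset.sum_neg_distrib] using h₂
  rw [e₁]
  have q₁ : ∀ i : ℕ, 2 * i % 2 = 0 := by omega
  have q₂ : ∀ i : ℕ, (2 * i + 1) % 2 ≠ 0 := by omega
  have q₃ : ∀ i : ℕ, 2 * i / 2 = i := by omega
  have q₄ : ∀ i : ℕ, (2 * i + 1) / 2 = i := by omega
  have s₁ : ∀ i : Fin (outVars r d),
      ∑ j : Fin (outVars r d), outBase (outVars r d) r d i j * x j = x i := by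
    intro i
    simp [outBase, Fin.val_inj]
  have s₂ : ∀ k : Fin r,
      ∑ j : Fin (outVars r d), outBase (outVars r d) r d (outVars r d + k) j * x j =
      x (Fin.castLE hr k) -
        ∑ j : Fin (outVars r d), if (j : ℕ) < r then 0 else (digit d k (j + 1 - r) : ℤ) * x j := by
    intro k
    have : ∀ j : Fin (outVars r d), outBase (outVars r d) r d (outVars r d + k) j * x j =
        (if j = Fin.castLE hr k then x j else 0) -
          if (j : ℕ) < r then 0 else (digit d k (j + 1 - r) : ℤ) * x j := by
      intro j
      by_cases hj : (j : ℕ) < r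
      · simp [outBase, hj, Fin.ext_iff]
      · have : (j : ℕ) ≠ k := by omega
        simp [outBase, hj, Fin.ext_iff, this]
    simp only [this, Finset.sum_sub_distrib, Finset.sum_ite_eq', Finset.mem_univ, if_true]
  have s₃ : ∑ j : Fin (outVars r d), outBase (outVars r d) r d (outVars r d + r) j * x j =
      ∑ j : Fin (outVars r d), if (j : ℕ) < r then 0 else x j := by
    refine Finset.sum_congr rfl fun j _ => ?_
    simp [outBase]
  constructor
  · intro h
    refine ⟨fun j => ?_, fun k => ?_, ?_⟩
    · have := h j (by omega)
      rw [s₁] at this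
      have hj : (j : ℕ) < outVars r d + r := by omega
      simp only [outRhs, q₁, q₂, q₃, q₄, if_true, if_false, hj, j.2] at this
      exact ⟨by omega, this.1⟩
    · have := h (outVars r d + k) (by omega)
      rw [s₂] at this
      have hk : (outVars r d) + (k : ℕ) < outVars r d + r := by omega
      have hk₁ : ¬ outVars r d + (k : ℕ) < r := by omega
      have hk₂ : ¬ outVars r d + (k : ℕ) < (outVars r d) := by omega
      simp only [outRhs, q₁, q₂, q₃, q₄, if_true, if_false, hk, hk₁, hk₂] at this
      linarith [this.1, this.2]
    · have := h (outVars r d + r) (by omega)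
      rw [s₃] at this
      have hk : ¬ outVars r d + r < outVars r d + r := by omega
      have hk₂ : ¬ outVars r d + r < (outVars r d) := by omega
      have hk₁ : ¬ outVars r d + r < r := by omega
      simp only [outRhs, q₁, q₂, q₃, q₄, if_true, if_false, hk, hk₁, hk₂] at this
      exact ⟨by linarith [this.2], this.1⟩
  · rintro ⟨h₁, h₂, h₃, h₄⟩ i hi
    by_cases hi₁ : i < (outVars r d)
    · have := h₁ ⟨i, hi₁⟩
      have hj : i < outVars r d + r := by omega
      rw [s₁ ⟨i, hi₁⟩]
      simp only [outRhs, q₁, q₂, q₃, q₄, if_true, if_false, hj, hi₁]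
      exact ⟨this.2, by linarith [this.1]⟩
    by_cases hi₂ : i < outVars r d + r
    · obtain ⟨k, rfl⟩ : ∃ k : Fin r, i = outVars r d + k :=
        ⟨⟨i - outVars r d, by omega⟩, by simp; omega⟩
      rw [s₂, h₂ k]
      have hk₁ : ¬ outVars r d + (k : ℕ) < r := by omega
      simp only [outRhs, q₁, q₂, q₃, q₄, if_true, if_false, hi₁, hi₂, hk₁]
      simp
    · obtain rfl : i = outVars r d + r := by omega
      rw [s₃]
      have hk₁ : ¬ outVars r d + r < r := by omega
      simp only [outRhs, q₁, q₂, q₃, q₄, if_true, if_false, hi₁, hi₂, hk₁]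
      exact ⟨h₄, by linarith⟩

/-- Nonnegative integers with sum at most `1` contain at most one nonzero entry, which is then `1`.
That entry names the assignment; if there is none, the assignment is zero and the lower bound `1 - F
0` on the sum forces `F 0 = 1`. -/
theorem mem_feasibleBoundary_outILP {r d : ℕ} (hd : 1 ≤ d) {F : ℕ → ℤ}
    (hF : ∀ c < d ^ r, F c = 0 ∨ F c = 1) (a : Fin r → ℤ) :
    a ∈ (outILP r d hd F).feasibleBoundary ↔
      ∃ c < d ^ r, F c = 1 ∧ ∀ k : Fin r, a k = digit d k c := by
  have hD : 1 ≤ d ^ r := Nat.one_le_pow r d hd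
  have hNr : outVars r d = r + d ^ r - 1 := rfl
  have hr := le_outVars (r := r) hd
  constructor
  · intro h
    obtain ⟨x, hx, ht⟩ : ∃ x : Fin (outVars r d) → ℤ,
        (∀ i : Fin (outILP r d hd F).m, ∑ j : Fin (outVars r d),
          (outILP r d hd F).A i j * x j ≤ (outILP r d hd F).b i) ∧
        ∀ k, x (Fin.castLE hr k) = a k := h
    obtain ⟨h₁, h₂, h₃, h₄⟩ := (outILP_feasible_iff hd F x).1 hx
    by_cases h0 : ∃ j₀ : Fin (outVars r d), ¬ (j₀ : ℕ) < r ∧ x j₀ ≠ 0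
    · obtain ⟨j₀, hj₀, hx₀⟩ := h0
      have hpos : ∀ j ∈ Finset.univ, 0 ≤ if ((j : Fin (outVars r d)) : ℕ) < r then 0 else x j := by
        intro j _
        split_ifs
        exacts [le_rfl, (h₁ j).1]
      have hj₁ : x j₀ = 1 := by
        have := Finset.single_le_sum hpos (Finset.mem_univ j₀)
        rw [if_neg hj₀] at this
        have := (h₁ j₀).1
        omega
      have hz : ∀ j : Fin (outVars r d), ¬ (j : ℕ) < r → j ≠ j₀ → x j = 0 := by
        intro j hj hne
        have := Finset.add_le_sum hpos (Finset.mem_univ j₀) (Finset.mem_univ j) hne.symm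
        rw [if_neg hj₀, if_neg hj, hj₁] at this
        have := (h₁ j).1
        omega
      have hc : (j₀ : ℕ) + 1 - r < d ^ r := by omega
      refine ⟨j₀ + 1 - r, hc, ?_, fun k => ?_⟩
      · have := (h₁ j₀).2
        rw [if_neg hj₀, hj₁] at this
        rcases hF _ hc with h | h <;> omega
      · rw [← ht, h₂ k, Finset.sum_eq_single j₀]
        · simp [hj₀, hj₁]
        · intro j _ hj
          split_ifs with h
          · rfl
          · simp [hz j h hj]
        · simp
    · push Not at h0
      have hs : ∀ k : ℕ, ∀ j : Fin (outVars r d),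
          (if (j : ℕ) < r then 0 else (digit d k (j + 1 - r) : ℤ) * x j) = 0 := by
        intro k j
        split_ifs with h
        · rfl
        · rw [h0 j (by omega), mul_zero]
      have hs' : ∀ j : Fin (outVars r d), (if (j : ℕ) < r then 0 else x j) = 0 := by
        intro j
        split_ifs with h
        · rfl
        · exact h0 j (by omega)
      refine ⟨0, hD, ?_, fun k => ?_⟩
      · simp only [hs', Finset.sum_const_zero] at h₃
        rcases hF 0 hD with h | h <;> omega
      · rw [← ht, h₂ k]
        rw [Finset.sum_eq_zero fun j _ => hs k j]
        simp [digit]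
  · rintro ⟨c, hc, hFc, ha⟩
    -- Column `j ≥ r` belongs to the number `j + 1 - r ≥ 1`. So exactly the indicator of `c`, in
    -- column `r + c - 1`, is set when `c` is positive, and none is set for `c = 0`.
    let x : Fin (outVars r d) → ℤ := fun j =>
      if (j : ℕ) < r then (digit d j c : ℤ) else if (j : ℕ) + 1 - r = c then 1 else 0
    refine ⟨x, (outILP_feasible_iff hd F x).2 ⟨fun j => ?_, fun k => ?_, ?_⟩, fun k => ?_⟩
    · simp only [x]
      split_ifs with h h'
      · have := digit_lt hd j c
        omega
      · rw [h', hFc]; omega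
      · rcases hF ((j : ℕ) + 1 - r) (by omega) with h | h <;> omega
    · have hk : x (Fin.castLE (le_outVars hd) k) = digit d k c := by simp [x]
      rw [hk]
      rcases Nat.eq_zero_or_pos c with rfl | hc0
      · rw [Finset.sum_eq_zero]
        · simp [digit]
        · intro j _
          by_cases hj : (j : ℕ) < r
          · simp [hj]
          · have : ¬ (j : ℕ) + 1 - r = 0 := by omega
            simp [x, hj, this]
      · rw [Finset.sum_eq_single (⟨r + c - 1, by omega⟩ : Fin (outVars r d))]
        · have e₁ : ¬ r + c - 1 < r := by omega
          have e₂ : r + c - 1 + 1 - r = c := by omega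
          simp [x, e₁, e₂]
        · intro j _ hj
          by_cases hj' : (j : ℕ) < r
          · simp [hj']
          · have : ¬ (j : ℕ) + 1 - r = c := fun h => hj (Fin.ext (by simp only; omega))
            simp [x, hj', this]
        · simp
    · rcases Nat.eq_zero_or_pos c with rfl | hc0
      · rw [Finset.sum_eq_zero]
        · rw [hFc]; omega
        · intro j _
          by_cases hj : (j : ℕ) < r
          · simp [hj]
          · have : ¬ (j : ℕ) + 1 - r = 0 := by omega
            simp [x, hj, this]
      · rw [Finset.sum_eq_single (⟨r + c - 1, by omega⟩ : Fin (outVars r d))]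
        · have e₁ : ¬ r + c - 1 < r := by omega
          have e₂ : r + c - 1 + 1 - r = c := by omega
          simp only [x, e₁, e₂, if_true, if_false]
          rcases hF 0 hD with h | h <;> omega
        · intro j _ hj
          by_cases hj' : (j : ℕ) < r
          · simp [hj']
          · have : ¬ (j : ℕ) + 1 - r = c := fun h => hj (Fin.ext (by simp only; omega))
            simp [x, hj', this]
        · simp
    · have : x (Fin.castLE (le_outVars hd) k) = digit d k c := by simp [x]
      exact this.trans (ha k).symm

theorem hasDomainSize_outILP {r d : ℕ} (hd : 1 ≤ d) {F : ℕ → ℤ}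
    (hF : ∀ c < d ^ r, F c = 0 ∨ F c = 1) : (outILP r d hd F).HasDomainSize d := by
  intro (j : Fin (outVars r d))
  have hNr : outVars r d = r + d ^ r - 1 := rfl
  have hr := le_outVars (r := r) hd
  have hj : (j : ℕ) < outVars r d := j.2
  refine ⟨⟨⟨2 * j + 1, by simp only [outILP]; omega⟩, ?_, 0, le_rfl, ?_⟩,
    ⟨2 * j, by simp only [outILP]; omega⟩, ?_, _, ?_, rfl⟩
  · funext (j' : Fin (outVars r d))
    change outEntry (outVars r d) r d (2 * j + 1) j' =
      (-Pi.single j 1 : Fin (outVars r d) → ℤ) j'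
    have h₁ : (2 * (j : ℕ) + 1) % 2 = 1 := by omega
    have h₂ : (2 * (j : ℕ) + 1) / 2 = j := by omega
    by_cases hjj : j' = j
    · simp [outEntry, outBase, h₁, h₂, hjj]
    · simp [outEntry, outBase, h₁, h₂, hj, hjj, Fin.val_inj]
  · have h₁ : ¬ (2 * (j : ℕ) + 1) % 2 = 0 := by omega
    have h₂ : (2 * (j : ℕ) + 1) / 2 = j := by omega
    have h₃ : (j : ℕ) < outVars r d + r := by omega
    simp [outILP, outRhs, h₂, h₃]
  · funext (j' : Fin (outVars r d))
    change outEntry (outVars r d) r d (2 * j) j' = (Pi.single j 1 : Fin (outVars r d) → ℤ) j'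
    have h₁ : (2 * (j : ℕ)) % 2 = 0 := by omega
    have h₂ : (2 * (j : ℕ)) / 2 = j := by omega
    by_cases hjj : j' = j
    · simp [outEntry, outBase, h₁, h₂, hjj]
    · simp [outEntry, outBase, h₁, h₂, hj, hjj, Fin.val_inj]
  · have h₁ : (2 * (j : ℕ)) % 2 = 0 := by omega
    have h₂ : (2 * (j : ℕ)) / 2 = j := by omega
    simp only [outILP, outRhs, h₁, h₂, hj, if_true]
    split_ifs with h
    · exact le_rfl
    -- For `d = 1` there is only the zero assignment, hence no indicator column. Otherwise the upper
    -- bound `F c ≤ 1` is at most `d - 1`.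
    · have hd2 : d ≠ 1 := by
        rintro rfl
        simp only [one_pow] at hNr
        omega
      rcases hF ((j : ℕ) + 1 - r) (by omega) with h | h <;> omega

theorem entriesBounded_outILP {r d : ℕ} (hd : 1 ≤ d) {F : ℕ → ℤ}
    (hF : ∀ c < d ^ r, F c = 0 ∨ F c = 1) : (outILP r d hd F).EntriesBounded d := by
  have hNr : outVars r d = r + d ^ r - 1 := rfl
  have hD : 1 ≤ d ^ r := Nat.one_le_pow r d hd
  constructor
  · intro i j
    have hb : -(d : ℤ) ≤ outBase (outVars r d) r d (i / 2) j ∧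
        outBase (outVars r d) r d (i / 2) j ≤ d := by
      have := digit_lt hd ((i : ℕ) / 2 - outVars r d) (j + 1 - r)
      unfold outBase
      split_ifs <;> omega
    have hA : (outILP r d hd F).A i j =
        (1 - 2 * (((i : ℕ) % 2 : ℕ) : ℤ)) * outBase (outVars r d) r d (i / 2) j := rfl
    rw [hA]
    rcases Nat.mod_two_eq_zero_or_one i with h | h <;> rw [h] <;> push_cast <;> constructor <;>
      linarith [hb.1, hb.2]
  · intro i
    have hb : (outILP r d hd F).b i = outRhs (outVars r d) r d F i := rfl
    rw [hb]
    unfold outRhs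
    split_ifs with h₁ h₂ h₃
    · omega
    · rcases hF ((i : ℕ) / 2 + 1 - r) (by omega) with h | h <;> omega
    · omega
    · omega
    · omega
    · rcases hF 0 hD with h | h <;> omega

namespace RAM

/-! ### Preparation: powers of `d` and markers for the boundary variables -/

/-- Test two expressions for equality. -/
def condEq (e₁ e₂ : Expr) (p q : Prog) : Prog :=
  .cond (.mul (.sub e₁ e₂) (.sub e₁ e₂)) (.const 0) p q

/-- Tests are limited to `≤`, and equality amounts to the square of the difference being at most
`0`. -/
theorem Halts.condEq {e₁ e₂ : Expr} {p q : Prog} {σ : State} {T : ℕ} {Q : State → Prop}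
    (hT : 2 * e₁.cost + 2 * e₂.cost + 5 ≤ T)
    (h₁ : e₁.val σ = e₂.val σ → Halts p σ (T - (2 * e₁.cost + 2 * e₂.cost + 5)) Q)
    (h₂ : e₁.val σ ≠ e₂.val σ → Halts q σ (T - (2 * e₁.cost + 2 * e₂.cost + 5)) Q) :
    Halts (RAM.condEq e₁ e₂ p q) σ T Q := by
  have hc : (Expr.mul (.sub e₁ e₂) (.sub e₁ e₂)).cost + (Expr.const 0).cost + 1 =
      2 * e₁.cost + 2 * e₂.cost + 5 := by simp only [Expr.cost]; ring
  have he : (Expr.mul (.sub e₁ e₂) (.sub e₁ e₂)).val σ ≤ (Expr.const 0).val σ ↔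
      e₁.val σ = e₂.val σ := by
    simp only [Expr.val]
    constructor
    · intro h
      have := mul_self_eq_zero.1 (le_antisymm h (mul_self_nonneg _))
      linarith
    · intro h; simp [h]
  refine Halts.cond (hc ▸ hT) ?_ ?_ <;> rw [hc, he]
  exacts [h₁, h₂]

/-- Compute `d ^ r` in the register `4` and the powers of `d` in the array `9`. -/
def powProg : Prog :=
  .seq (.assign 4 (.const 1)) (.seq (.store 9 (.const 0) (.const 1))
    (forLoop 7 2 (.seq (.assign 4 (.mul (.reg 4) (.reg 3)))
      (.store 9 (.add (.reg 7) (.const 1)) (.reg 4)))))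

theorem halts_powProg {σ : State} {r d : ℕ} (hr : σ.regs 2 = r) (hd : σ.regs 3 = d) :
    Halts powProg σ (18 * r + 12) fun σ' =>
      σ'.regs 4 = ((d ^ r : ℕ) : ℤ) ∧ ∀ k ≤ r, σ'.arrs 9 (k : ℕ) = ((d ^ k : ℕ) : ℤ) := by
  refine Halts.assign_seq (by simp [Expr.cost]) (Halts.store_seq (by simp [Expr.cost]) ?_)
  refine Halts.mono (Halts.forLoop (N := r) (T := 9) (fun k σ =>
    σ.regs 4 = ((d ^ k : ℕ) : ℤ) ∧ ∀ j ≤ k, σ.arrs 9 (j : ℕ) = ((d ^ j : ℕ) : ℤ))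
    (by simp [hr]) (by decide) (by simp [Prog.WritesReg]) (by simp [Prog.WritesReg])
    (by simp [Expr.val]) ?_) ?_ fun _ _ h => h
  · rintro k hk τ hf h7 ⟨h4, h9⟩
    have h3 : τ.regs 3 = d := by
      rw [hf.regs 3 (by simp [RAM.forLoop, Prog.WritesReg])]; simp [hd]
    refine Halts.assign_seq (by simp [Expr.cost]) (Halts.store (by simp [Expr.cost]) ?_)
    have h : (τ.setReg 4 ((Expr.mul (.reg 4) (.reg 3)).val τ)).regs 4 =
        ((d ^ (k + 1) : ℕ) : ℤ) := by
      simp [Expr.val, h4, h3, pow_succ]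
    refine ⟨by simpa using h, fun j hj => ?_⟩
    rcases Nat.lt_or_ge k j with hkj | hkj
    · obtain rfl : j = k + 1 := by omega
      simp [Expr.val, h7, h4, h3, pow_succ]
    · have : (j : ℤ) ≠ k + 1 := by omega
      simpa [Expr.val, h7, this] using h9 j hkj
  · simp only [Expr.cost]; omega

/-- Mark the boundary variables in the array `10`. -/
def markProg : Prog := forLoop 7 2 (.store 10 (.get 2 (.reg 7)) (.const 1))

theorem halts_markProg {σ : State} {r : ℕ} (hr : σ.regs 2 = r) (h0 : σ.arrs 10 = 0) :
    Halts markProg σ (13 * r + 7) fun σ' =>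
      (∀ k < r, σ'.arrs 10 (σ.arrs 2 (k : ℕ)) = 1) ∧
        ∀ z, (∀ k < r, σ.arrs 2 (k : ℕ) ≠ z) → σ'.arrs 10 z = 0 := by
  refine Halts.mono (Halts.forLoop (N := r) (T := 4) (fun j τ =>
      (∀ k < j, τ.arrs 10 (σ.arrs 2 (k : ℕ)) = 1) ∧
        ∀ z, (∀ k < j, σ.arrs 2 (k : ℕ) ≠ z) → τ.arrs 10 z = 0) hr (by decide)
    (by simp [Prog.WritesReg]) (by simp [Prog.WritesReg]) (by simp [h0]) ?_) (by omega)
    fun _ _ h => h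
  rintro j hj τ hf h7 ⟨h₁, h₂⟩
  have ha : τ.arrs 2 = σ.arrs 2 := hf.arrs 2 (by simp [RAM.forLoop, Prog.WritesArr])
  refine Halts.store (by simp [Expr.cost]) ⟨fun k hk => ?_, fun z hz => ?_⟩
  · rcases Nat.lt_succ_iff_lt_or_eq.1 hk with hk | rfl
    · simp [Expr.val, h7, ha, h₁ k hk]
    · simp [Expr.val, h7, ha]
  · have hne : z ≠ σ.arrs 2 (j : ℕ) := (hz j (by omega)).symm
    simp [Expr.val, h7, ha, hne, h₂ z fun k hk => hz k (by omega)]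

variable {r : ℕ}

/-- The memory holds the input `I` and the data prepared from it. -/
structure Prepared (I : BoundariedILP r) (d : ℕ) (σ : State) : Prop where
  reg_n : σ.regs 0 = I.n
  reg_m : σ.regs 1 = I.m
  reg_r : σ.regs 2 = r
  reg_d : σ.regs 3 = d
  reg_pow : σ.regs 4 = ((d ^ r : ℕ) : ℤ)
  reg_mul : σ.regs 10 = ((I.m * I.n : ℕ) : ℤ)
  matrix : ∀ (i : Fin I.m) (j : Fin I.n), σ.arrs 0 ((i : ℕ) * I.n + (j : ℕ)) = I.A i j
  rhs : ∀ i : Fin I.m, σ.arrs 1 (i : ℕ) = I.b i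
  boundary : ∀ k : Fin r, σ.arrs 2 (k : ℕ) = ((I.t k : ℕ) : ℤ)
  pow : ∀ k ≤ r, σ.arrs 9 (k : ℕ) = ((d ^ k : ℕ) : ℤ)
  marked : ∀ j : Fin I.n, σ.arrs 10 (j : ℕ) = if ∃ k, I.t k = j then 1 else 0

theorem Prepared.frame {I : BoundariedILP r} {d : ℕ} {p : Prog} {σ σ' : State}
    (h : Prepared I d σ) (hf : Frame p σ σ') (hr : ∀ x ∈ [0, 1, 2, 3, 4, 10], ¬ p.WritesReg x)
    (ha : ∀ a ∈ [0, 1, 2, 9, 10], ¬ p.WritesArr a) : Prepared I d σ' := by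
  constructor
  · rw [hf.regs _ (hr _ (by simp)), h.reg_n]
  · rw [hf.regs _ (hr _ (by simp)), h.reg_m]
  · rw [hf.regs _ (hr _ (by simp)), h.reg_r]
  · rw [hf.regs _ (hr _ (by simp)), h.reg_d]
  · rw [hf.regs _ (hr _ (by simp)), h.reg_pow]
  · rw [hf.regs _ (hr _ (by simp)), h.reg_mul]
  · rw [hf.arrs _ (ha _ (by simp))]; exact h.matrix
  · rw [hf.arrs _ (ha _ (by simp))]; exact h.rhs
  · rw [hf.arrs _ (ha _ (by simp))]; exact h.boundary
  · rw [hf.arrs _ (ha _ (by simp))]; exact h.pow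
  · rw [hf.arrs _ (ha _ (by simp))]; exact h.marked

/-! ### Contents of the encoded input -/

theorem ofMatrix_apply {m n : ℕ} (A : Matrix (Fin m) (Fin n) ℤ) (i : Fin m) (j : Fin n) :
    ofMatrix A ((i : ℕ) * n + (j : ℕ)) = A i j := by
  have key : ∀ (i' : Fin m) (j' : Fin n),
      ((i : ℕ) : ℤ) * n + (j : ℕ) = (i' : ℕ) * n + (j' : ℕ) ↔ i' = i ∧ j' = j := by
    intro i' j'
    constructor
    · intro h
      have := eq_of_mul_add_eq (K := n) (z := (i : ℕ)) (z' := (i' : ℕ)) (u := (j : ℕ))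
        (v := (j' : ℕ)) (by omega) (by omega) (by omega) (by omega) (by linarith)
      exact ⟨Fin.ext (by omega), Fin.ext (by omega)⟩
    · rintro ⟨rfl, rfl⟩; rfl
  unfold ofMatrix
  simp only [key]
  rw [Finset.sum_eq_single i, Finset.sum_eq_single j] <;> simp +contextual

theorem ofMatrix_eq_zero {m n : ℕ} (A : Matrix (Fin m) (Fin n) ℤ) {z : ℤ}
    (hz : ¬ (0 ≤ z ∧ z < (m * n : ℕ))) : ofMatrix A z = 0 := by
  refine Finset.sum_eq_zero fun i _ => Finset.sum_eq_zero fun j _ => if_neg ?_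
  rintro rfl
  refine hz ⟨by positivity, ?_⟩
  have h₁ : (i : ℕ) + 1 ≤ m := i.2
  have h₂ := Nat.mul_le_mul_right n h₁
  have h₃ := j.2
  have : (i : ℕ) * n + (j : ℕ) < m * n := by nlinarith
  exact_mod_cast this

theorem ofVec_apply {k : ℕ} (v : Fin k → ℤ) (i : Fin k) : ofVec v (i : ℕ) = v i := by
  unfold ofVec
  rw [Finset.sum_eq_single i]
  · simp
  · intro j _ hj
    exact if_neg fun h => hj (Fin.ext (by omega))
  · simp

theorem ofVec_eq_zero {k : ℕ} (v : Fin k → ℤ) {z : ℤ} (hz : ¬ (0 ≤ z ∧ z < k)) :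
    ofVec v z = 0 := by
  refine Finset.sum_eq_zero fun i _ => if_neg ?_
  rintro rfl
  exact hz ⟨by omega, by omega⟩

/-- The preparation of the memory. -/
def prepProg : Prog := .seq (.assign 10 (.mul (.reg 1) (.reg 0))) (.seq powProg markProg)

theorem halts_prepProg (I : BoundariedILP r) (d : ℕ) :
    Halts prepProg (I.input d) (31 * r + 23) fun σ =>
      Prepared I d σ ∧ σ.regs 6 = 0 ∧ ∀ a ∈ [3, 4, 5, 6, 7, 8], σ.arrs a = 0 := by
  have hreg : ∀ x, (I.input d).regs x = [(I.n : ℤ), (I.m : ℤ), (r : ℤ), (d : ℤ)].getD x 0 :=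
    fun _ => rfl
  have harr : ∀ a, (I.input d).arrs a =
      [ofMatrix I.A, ofVec I.b, ofVec fun k => ((I.t k : ℕ) : ℤ)].getD a 0 := fun _ => rfl
  refine Halts.mono (Q := fun σ => Frame prepProg (I.input d) σ ∧
    σ.regs 10 = ((I.m * I.n : ℕ) : ℤ) ∧ σ.regs 4 = ((d ^ r : ℕ) : ℤ) ∧
    (∀ k ≤ r, σ.arrs 9 (k : ℕ) = ((d ^ k : ℕ) : ℤ)) ∧
    ∀ j : Fin I.n, σ.arrs 10 (j : ℕ) = if ∃ k, I.t k = j then 1 else 0) ?_ le_rfl ?_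
  · refine Halts.mono (T := 31 * r + 23) (Q := fun σ =>
      σ.regs 10 = ((I.m * I.n : ℕ) : ℤ) ∧ σ.regs 4 = ((d ^ r : ℕ) : ℤ) ∧
      (∀ k ≤ r, σ.arrs 9 (k : ℕ) = ((d ^ k : ℕ) : ℤ)) ∧
      ∀ j : Fin I.n, σ.arrs 10 (j : ℕ) = if ∃ k, I.t k = j then 1 else 0) ?_ le_rfl
      fun σ hf h => ⟨hf, h⟩
    refine Halts.assign_seq (by simp [Expr.cost]) ?_
    refine Halts.seq (18 * r + 12) (13 * r + 7) (by simp [Expr.cost]; omega) ?_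
    refine Halts.mono (halts_powProg (r := r) (d := d) (by simp [hreg]) (by simp [hreg])) le_rfl ?_
    rintro σ₁ hf₁ ⟨h4, h9⟩
    refine Halts.mono (halts_markProg (r := r) ?_ ?_) le_rfl ?_
    · rw [hf₁.regs 2 (by simp [powProg, RAM.forLoop, Prog.WritesReg])]; simp [hreg]
    · rw [hf₁.arrs 10 (by simp [powProg, RAM.forLoop, Prog.WritesArr])]; simp [harr]
    rintro σ₂ hf₂ ⟨h₁, h₂⟩
    have h2 : σ₁.arrs 2 = ofVec fun k => ((I.t k : ℕ) : ℤ) := by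
      rw [hf₁.arrs 2 (by simp [powProg, RAM.forLoop, Prog.WritesArr])]; simp [harr]
    refine ⟨?_, ?_, ?_, fun j => ?_⟩
    · rw [hf₂.regs 10 (by simp [markProg, RAM.forLoop, Prog.WritesReg]),
        hf₁.regs 10 (by simp [powProg, RAM.forLoop, Prog.WritesReg])]
      simp [Expr.val, hreg]
    · rw [hf₂.regs 4 (by simp [markProg, RAM.forLoop, Prog.WritesReg]), h4]
    · rw [hf₂.arrs 9 (by simp [markProg, RAM.forLoop, Prog.WritesArr])]; exact h9
    · split_ifs with h
      · obtain ⟨k, rfl⟩ := h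
        have := h₁ k k.2
        rwa [h2, ofVec_apply (fun k => ((I.t k : ℕ) : ℤ)) k] at this
      · refine h₂ _ fun k hk => ?_
        rw [h2, ofVec_apply (fun k => ((I.t k : ℕ) : ℤ)) ⟨k, hk⟩]
        exact fun h' => h ⟨⟨k, hk⟩, Fin.ext (by omega)⟩
  · rintro σ - ⟨hf, h10, h4, h9, hm⟩
    have hr : ∀ x ∈ [0, 1, 2, 3, 6], σ.regs x = (I.input d).regs x := by
      intro x hx
      refine hf.regs x ?_
      simp at hx
      rcases hx with rfl | rfl | rfl | rfl | rfl <;>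
        simp [prepProg, powProg, markProg, RAM.forLoop, Prog.WritesReg]
    have ha : ∀ a ∈ [0, 1, 2, 3, 4, 5, 6, 7, 8], σ.arrs a = (I.input d).arrs a := by
      intro a ha
      refine hf.arrs a ?_
      simp at ha
      rcases ha with rfl | rfl | rfl | rfl | rfl | rfl | rfl | rfl | rfl <;>
        simp [prepProg, powProg, markProg, RAM.forLoop, Prog.WritesArr]
    refine ⟨⟨?_, ?_, ?_, ?_, h4, h10, fun i j => ?_, fun i => ?_, fun k => ?_, h9, hm⟩, ?_, ?_⟩
    · rw [hr 0 (by simp)]; simp [hreg]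
    · rw [hr 1 (by simp)]; simp [hreg]
    · rw [hr 2 (by simp)]; simp [hreg]
    · rw [hr 3 (by simp)]; simp [hreg]
    · rw [ha 0 (by simp), harr]; exact ofMatrix_apply I.A i j
    · rw [ha 1 (by simp), harr]; exact ofVec_apply I.b i
    · rw [ha 2 (by simp), harr]; exact ofVec_apply (fun k => ((I.t k : ℕ) : ℤ)) k
    · rw [hr 6 (by simp)]; simp [hreg]
    · intro a ha'
      rw [ha a (by simp at ha' ⊢; tauto), harr]
      simp at ha'
      rcases ha' with rfl | rfl | rfl | rfl | rfl | rfl <;> simp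

/-! ### Solving the linear program of one boundary assignment -/

/-- The digit with the number `k` of `c`. -/
def digitExpr (k c : Expr) : Expr :=
  .sub (.div c (.get 9 k)) (.mul (.reg 3) (.div c (.get 9 (.add k (.const 1)))))

/-- The machine has no remainder operation. The digit is `c / d ^ k` minus `d` times the next
quotient `c / d ^ (k + 1)`, which is `(c / d ^ k) / d`. -/
theorem digitExpr_val {σ : State} {d r k c : ℕ} (h3 : σ.regs 3 = d)
    (h9 : ∀ k ≤ r, σ.arrs 9 (k : ℕ) = ((d ^ k : ℕ) : ℤ)) (hk : k < r) {ek ec : Expr}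
    (hek : ek.val σ = k) (hec : ec.val σ = c) : (digitExpr ek ec).val σ = digit d k c := by
  have h₁ := h9 k hk.le
  have h₂ := h9 (k + 1) hk
  push_cast at h₂
  simp only [digitExpr, Expr.val, hek, hec, h3, h₁, h₂, digit]
  push_cast
  rw [Int.emod_def, Int.ediv_ediv_of_nonneg (by positivity), pow_succ]

/-- Write the matrix with zero boundary columns into the simulated memory. -/
def loadMatrix (B : ℕ) : Prog :=
  forLoop 7 10 (logStore (cellAddr B 0 (.reg 7)) (.mul (.get 0 (.reg 7))
    (.sub (.const 1) (.get 10 (.sub (.reg 7) (.mul (.reg 0) (.div (.reg 7) (.reg 0))))))))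

/-- Write the right-hand side for the assignment with the number in register `5` into the
simulated memory. -/
def loadRhs (B : ℕ) : Prog :=
  forLoop 7 1 (.seq (.assign 9 (.get 1 (.reg 7)))
    (.seq (forLoop 8 2 (.assign 9 (.sub (.reg 9)
        (.mul (.get 0 (.add (.mul (.reg 7) (.reg 0)) (.get 2 (.reg 8))))
          (digitExpr (.reg 8) (.reg 5))))))
      (logStore (cellAddr B 1 (.reg 7)) (.reg 9))))

/-- The initial memory of an LP solver of which only the first `p` cells of the matrix and the
first `q` cells of the right-hand side have been written. -/
def partialInput {m n : ℕ} (A : Matrix (Fin m) (Fin n) ℤ) (b : Fin m → ℤ) (p q : ℕ) : State where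
  regs := initRegs [(n : ℤ), (m : ℤ)]
  arrs := initArrs [fun z => if 0 ≤ z ∧ z < p then ofMatrix A z else 0,
    fun z => if 0 ≤ z ∧ z < q then ofVec b z else 0]

theorem State.ext {σ τ : State} (h₁ : σ.regs = τ.regs) (h₂ : σ.arrs = τ.arrs) : σ = τ := by
  cases σ; cases τ; simp_all

theorem partialInput_eq_lpInput {m n : ℕ} (A : Matrix (Fin m) (Fin n) ℤ) (b : Fin m → ℤ) :
    partialInput A b (m * n) m = lpInput A b := by
  refine State.ext rfl ?_
  have h₁ : (fun z : ℤ => if 0 ≤ z ∧ z < (m * n : ℕ) then ofMatrix A z else 0) = ofMatrix A := by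
    funext z
    split_ifs with h
    exacts [rfl, (ofMatrix_eq_zero A h).symm]
  have h₂ : (fun z : ℤ => if 0 ≤ z ∧ z < m then ofVec b z else 0) = ofVec b := by
    funext z
    split_ifs with h
    exacts [rfl, (ofVec_eq_zero b h).symm]
  unfold partialInput lpInput
  rw [h₁, h₂]

theorem update_cut (f : ℤ → ℤ) (p : ℕ) :
    Function.update (fun z : ℤ => if 0 ≤ z ∧ z < p then f z else 0) p (f p) =
      fun z : ℤ => if 0 ≤ z ∧ z < (p + 1 : ℕ) then f z else 0 := by
  funext z
  rw [Function.update_apply]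
  by_cases hz : z = p
  · subst hz
    rw [if_pos rfl, if_pos]
    push_cast; omega
  · rw [if_neg hz]
    refine if_congr ?_ rfl rfl
    push_cast; omega

theorem partialInput_setArr_zero {m n : ℕ} (A : Matrix (Fin m) (Fin n) ℤ) (b : Fin m → ℤ)
    (p q : ℕ) : (partialInput A b p q).setArr 0 p (ofMatrix A p) = partialInput A b (p + 1) q := by
  refine State.ext rfl ?_
  funext a
  rcases a with _ | _ | a
  · simp only [State.setArr, partialInput, initArrs, Function.update_self,
      List.getD_cons_zero, update_cut]
  · simp [State.setArr, partialInput, initArrs]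
  · simp [State.setArr, partialInput, initArrs]

theorem partialInput_setArr_one {m n : ℕ} (A : Matrix (Fin m) (Fin n) ℤ) (b : Fin m → ℤ)
    (p q : ℕ) : (partialInput A b p q).setArr 1 q (ofVec b q) = partialInput A b p (q + 1) := by
  refine State.ext rfl ?_
  funext a
  rcases a with _ | _ | a
  · simp [State.setArr, partialInput, initArrs]
  · simp only [State.setArr, partialInput, initArrs, zero_add, Function.update_self,
      List.getD_cons_zero, List.getD_cons_succ, update_cut]
  · simp [State.setArr, partialInput, initArrs]

theorem Represents.congr {B : ℕ} {σ τ τ' : State} (h : Represents B σ τ)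
    (h' : τ'.arrs 6 = τ.arrs 6) : Represents B σ τ' :=
  ⟨fun x => by rw [h']; exact h.regs x, fun a ha z => by rw [h']; exact h.arrs a ha z⟩

theorem Logged.congr {k : ℕ} {τ τ' : State} (h : Logged k τ) (h₁ : τ'.regs 6 = τ.regs 6)
    (h₂ : τ'.arrs 6 = τ.arrs 6) (h₃ : τ'.arrs 7 = τ.arrs 7) : Logged k τ' :=
  ⟨h₁.trans h.count, by rw [h₂, h₃]; exact h.mem⟩

theorem halts_loadMatrix {I : BoundariedILP r} {d B k : ℕ} (hB : 2 ≤ B) (b : Fin I.m → ℤ)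
    {σ : State} (hσ : Prepared I d σ) (hl : Logged k σ)
    (hr : Represents B (partialInput I.fixedMatrix b 0 0) σ) :
    Halts (loadMatrix B) σ (39 * (I.m * I.n) + 7) fun σ' =>
      Logged (k + I.m * I.n) σ' ∧
        Represents B (partialInput I.fixedMatrix b (I.m * I.n) 0) σ' := by
  refine Halts.mono (Halts.forLoop (N := I.m * I.n) (T := 30) (fun p σ' =>
    Logged (k + p) σ' ∧ Represents B (partialInput I.fixedMatrix b p 0) σ') hσ.reg_mul (by decide)
    (by simp [Prog.WritesReg, logStore]) (by simp [Prog.WritesReg, logStore])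
    ⟨hl.congr (by simp) rfl rfl, hr.congr rfl⟩ ?_) (by omega) fun _ _ h => h
  rintro p hp τ hf h7 ⟨hl', hr'⟩
  have hτ : Prepared I d τ := hσ.frame hf
    (by simp [RAM.forLoop, Prog.WritesReg, logStore])
    (by simp [RAM.forLoop, Prog.WritesArr, logStore])
  obtain ⟨τ', he, hl₁, hv⟩ := exec_logStore hl' (i := cellAddr B 0 (.reg 7))
    (e := .mul (.get 0 (.reg 7)) (.sub (.const 1)
      (.get 10 (.sub (.reg 7) (.mul (.reg 0) (.div (.reg 7) (.reg 0)))))))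
    (by simp [Expr.LogFree, cellAddr]) (by simp [Expr.LogFree])
  have hn : 0 < I.n := Nat.pos_of_ne_zero fun h => by simp [h] at hp
  -- The flat index `p` is split into row and column; `n` is positive because `p < m * n`.
  let i : Fin I.m := ⟨p / I.n, Nat.div_lt_of_lt_mul (by rwa [mul_comm])⟩
  let j : Fin I.n := ⟨p % I.n, Nat.mod_lt _ hn⟩
  have hp' : (p : ℤ) = (i : ℕ) * I.n + (j : ℕ) := by
    have := Nat.div_add_mod' p I.n
    simp only [i, j]
    exact_mod_cast this.symm
  have hj : (p : ℤ) - I.n * ((p : ℤ) / I.n) = (j : ℕ) := by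
    rw [← Int.emod_def]; simp [j]
  have hval : (Expr.mul (.get 0 (.reg 7)) (.sub (.const 1)
      (.get 10 (.sub (.reg 7) (.mul (.reg 0) (.div (.reg 7) (.reg 0))))))).val τ =
      ofMatrix I.fixedMatrix p := by
    simp only [Expr.val, h7, hτ.reg_n, hj, hτ.marked j]
    rw [hp', ofMatrix_apply, hτ.matrix]
    unfold BoundariedILP.fixedMatrix
    split_ifs <;> simp
  refine ⟨_, _, he, by simp [cellAddr, Expr.cost], hl₁.congr (by simp) rfl rfl, ?_⟩
  rw [← partialInput_setArr_zero]
  refine Represents.congr (τ := τ') (hr'.setArr (by omega) _ _ fun w => ?_) rfl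
  rw [hv, hval]
  simp [cellAddr, Expr.val, h7]

theorem halts_loadRhs {I : BoundariedILP r} {d B k c p : ℕ} (hB : 2 ≤ B)
    {A : Matrix (Fin I.m) (Fin I.n) ℤ} {σ : State} (hσ : Prepared I d σ) (h5 : σ.regs 5 = c)
    (hl : Logged k σ)
    (hr : Represents B (partialInput A (I.fixedRhs fun k => digit d k c) p 0) σ) :
    Halts (loadRhs B) σ (I.m * (40 * r + 60) + 7) fun σ' =>
      Logged (k + I.m) σ' ∧
        Represents B (partialInput A (I.fixedRhs fun k => digit d k c) p I.m) σ' := by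
  refine Halts.mono (Halts.forLoop (N := I.m) (T := 40 * r + 50) (fun q σ' =>
    Logged (k + q) σ' ∧ Represents B (partialInput A (I.fixedRhs fun k => digit d k c) p q) σ')
    hσ.reg_m (by decide)
    (by simp [Prog.WritesReg, logStore, RAM.forLoop])
    (by simp [Prog.WritesReg, logStore, RAM.forLoop])
    ⟨hl.congr (by simp) rfl rfl, hr.congr rfl⟩ ?_) (by nlinarith) fun _ _ h => h
  rintro q hq τ hf h7 ⟨hl', hr'⟩
  have hτ : Prepared I d τ := hσ.frame hf
    (by simp [RAM.forLoop, Prog.WritesReg, logStore])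
    (by simp [RAM.forLoop, Prog.WritesArr, logStore])
  have h5' : τ.regs 5 = c :=
    (hf.regs 5 (by simp [RAM.forLoop, Prog.WritesReg, logStore])).trans h5
  let i : Fin I.m := ⟨q, hq⟩
  let f : ℕ → ℤ := fun k => τ.arrs 0 ((q : ℤ) * I.n + τ.arrs 2 (k : ℕ)) * digit d k c
  -- The inner loop subtracts the contribution of one boundary variable after another; this is its
  -- final value.
  have hsum : τ.arrs 1 (q : ℕ) - ∑ k ∈ Finset.range r, f k =
      I.fixedRhs (fun k => digit d k c) i := by
    rw [Finset.sum_range, BoundariedILP.fixedRhs, ← hτ.rhs]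
    congr 1
    refine Finset.sum_congr rfl fun k _ => ?_
    simp only [f]
    rw [hτ.boundary, ← hτ.matrix]
  refine Halts.assign_seq (by simp [Expr.cost]) ?_
  refine Halts.seq (r * 33 + 7) 30 (by simp only [Expr.cost]; omega) ?_
  refine Halts.mono (Halts.forLoop (N := r) (T := 24) (fun k σ' =>
    σ'.regs 9 = τ.arrs 1 (q : ℕ) - ∑ k ∈ Finset.range k, f k) (by simp [hτ.reg_r]) (by decide)
    (by simp [Prog.WritesReg]) (by simp [Prog.WritesReg]) (by simp [Expr.val, h7]) ?_) le_rfl ?_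
  · rintro j hj τ₁ hf₁ h8 h9
    have hτ' : Prepared I d (τ.setReg 9 ((Expr.get 1 (.reg 7)).val τ)) :=
      hτ.frame (Exec.assign τ 9 (.get 1 (.reg 7))).frame
        (by simp [Prog.WritesReg]) (by simp [Prog.WritesArr])
    have hτ₁ : Prepared I d τ₁ := hτ'.frame hf₁
      (by simp [RAM.forLoop, Prog.WritesReg]) (by simp [RAM.forLoop, Prog.WritesArr])
    have h0 : τ₁.arrs 0 = τ.arrs 0 := hf₁.arrs 0 (by simp [RAM.forLoop, Prog.WritesArr])
    have h2 : τ₁.arrs 2 = τ.arrs 2 := hf₁.arrs 2 (by simp [RAM.forLoop, Prog.WritesArr])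
    have h7₁ : τ₁.regs 7 = q := by
      rw [hf₁.regs 7 (by simp [RAM.forLoop, Prog.WritesReg])]; simp [h7]
    have h5₁ : τ₁.regs 5 = c := by
      rw [hf₁.regs 5 (by simp [RAM.forLoop, Prog.WritesReg])]; simp [h5']
    have hdig := digitExpr_val hτ₁.reg_d hτ₁.pow hj (ek := .reg 8) (ec := .reg 5) h8 h5₁
    refine Halts.assign (by simp [Expr.cost, digitExpr]) ?_
    simp only [State.setReg_regs, Expr.val, hdig, h9, h7₁, h8, h0, h2, hτ₁.reg_n,
      Finset.sum_range_succ, f]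
    simp only [if_true, if_neg (show (9 : ℕ) ≠ 8 by decide)]
    ring
  · intro τ₂ hf₂ h9
    have h7₂ : τ₂.regs 7 = q := by
      rw [hf₂.regs 7 (by simp [RAM.forLoop, Prog.WritesReg])]; simp [h7]
    have h6 : τ₂.arrs 6 = τ.arrs 6 := hf₂.arrs 6 (by simp [RAM.forLoop, Prog.WritesArr])
    have hl₂ : Logged (k + q) τ₂ := hl'.congr
      (by rw [hf₂.regs 6 (by simp [RAM.forLoop, Prog.WritesReg])]; simp) h6
      (hf₂.arrs 7 (by simp [RAM.forLoop, Prog.WritesArr]))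
    obtain ⟨τ', he, hl₁, hv⟩ := exec_logStore hl₂ (i := cellAddr B 1 (.reg 7)) (e := .reg 9)
      (by simp [Expr.LogFree, cellAddr]) (by simp [Expr.LogFree])
    refine ⟨_, _, he, by simp [cellAddr, Expr.cost], hl₁.congr (by simp) rfl rfl, ?_⟩
    rw [← partialInput_setArr_one]
    refine Represents.congr (τ := τ') ((hr'.congr h6).setArr (by omega) _ _ fun w => ?_) rfl
    rw [hv]
    have hq' := ofVec_apply (I.fixedRhs fun k => digit d k c) i
    rw [← hsum] at hq'
    simp only [i] at hq'
    rw [hq']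
    simp [cellAddr, Expr.val, h7₂, h9]

end RAM

namespace RAM

variable {r : ℕ}

/-- Record in the array `8` whether the simulated solver has answered "feasible". -/
def recordAnswer : Prog :=
  condEq (.get 6 (.const 0)) (.const 1) (.store 8 (.reg 5) (.const 1))
    (.store 8 (.reg 5) (.const 0))

/-- Decide whether the boundary assignment with the number in register `5` is feasible. -/
def solveOne (S : Prog) (B : ℕ) : Prog :=
  .seq (logStore (regAddr B 0) (.reg 0)) (.seq (logStore (regAddr B 1) (.reg 1))
    (.seq (loadMatrix B) (.seq (loadRhs B) (.seq (S.translate B) (.seq recordAnswer clearLog)))))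

theorem solveOne_writesReg {S : Prog} {B x : ℕ} (h : (solveOne S B).WritesReg x) :
    x ∈ [6, 7, 8, 9] := by
  simp only [solveOne, logStore, loadMatrix, loadRhs, recordAnswer, condEq, clearLog, forLoop,
    Prog.WritesReg, or_false, false_or] at h
  rcases h with h | h | h | h | h | h
  · simp [h]
  · simp [h]
  · rcases h with h | h | h <;> simp [h]
  · rcases h with h | (h | (h | h | h) | h) | h <;> simp [h]
  · simp [Prog.eq_of_writesReg_translate h]
  · simp [h]

theorem solveOne_writesArr {S : Prog} {B a : ℕ} (h : (solveOne S B).WritesArr a) :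
    a ∈ [6, 7, 8] := by
  simp only [solveOne, logStore, loadMatrix, loadRhs, recordAnswer, condEq, clearLog, forLoop,
    Prog.WritesArr, or_false, false_or] at h
  have ht := fun h' => Prog.of_writesArr_translate (B := B) (a := a) (p := S) h'
  simp only [List.mem_cons, List.not_mem_nil]
  tauto

/-- With no cells loaded both arrays are zero, so the partial input is the zero state with two
registers set. -/
theorem represents_partialInput_zero {m n B : ℕ} (A : Matrix (Fin m) (Fin n) ℤ) (b : Fin m → ℤ)
    {τ : State}
    (h : Represents B (((⟨fun _ => 0, fun _ _ => 0⟩ : State).setReg 0 n).setReg 1 m) τ) :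
    Represents B (partialInput A b 0 0) τ := by
  have e : ((⟨fun _ => 0, fun _ _ => 0⟩ : State).setReg 0 n).setReg 1 m =
      partialInput A b 0 0 := by
    refine State.ext ?_ ?_
    · funext x
      rcases x with _ | _ | x <;> simp [State.setReg_regs, partialInput, initRegs]
    · funext a z
      rcases a with _ | _ | a <;> simp [partialInput, initArrs]
  rwa [← e]

/-- The simulated memory is zero before and after, so the next call finds the clean memory that the
solver's specification demands. Every cost is charged to `g`, through `m * n + m ≤ g`, `r ≤ n` and
`1 ≤ g`. -/
theorem halts_solveOne {S : Prog} {g : ℕ → ℕ → ℕ} (hS : IsLPSolver S g) {B : ℕ}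
    (hB : 2 ≤ B) (hSB : S.arrBound ≤ B) {I : BoundariedILP r} {d c : ℕ} (hI : I.HasDomainSize d)
    (hA : I.innerMatrix.IsTotallyUnimodular) {σ : State} (hσ : Prepared I d σ)
    (h5 : σ.regs 5 = c) (h6 : σ.regs 6 = 0) (h6' : σ.arrs 6 = 0) :
    Halts (solveOne S B) σ (260 * g I.n I.m) fun σ' =>
      σ'.regs 6 = 0 ∧ σ'.arrs 6 = 0 ∧ (∀ z : ℤ, z ≠ c → σ'.arrs 8 z = σ.arrs 8 z) ∧
        (σ'.arrs 8 c = 0 ∨ σ'.arrs 8 c = 1) ∧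
        (σ'.arrs 8 c = 1 ↔ (fun k : Fin r => (digit d k c : ℤ)) ∈ I.feasibleBoundary) := by
  set b := I.fixedRhs fun k => (digit d k c : ℤ) with hb
  have hmn := hI.two_mul_le
  have hg := hS.le_runtime hmn
  have hrn := I.le_n
  obtain ⟨t, ρ, hρ, ht, hans⟩ := hS I.n I.m I.fixedMatrix b
  have ht1 := hρ.one_le
  have hmr : I.m * r ≤ I.m * I.n := Nat.mul_le_mul_left _ hrn
  have hl₀ : Logged 0 σ := ⟨by simp [h6], fun w hw => absurd (by simp [h6']) hw⟩
  have hr₀ : Represents B ⟨fun _ => 0, fun _ _ => 0⟩ σ :=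
    ⟨fun x => by simp [h6'], fun a _ z => by simp [h6']⟩
  obtain ⟨σ₁, e₁, hl₁, hv₁⟩ := exec_logStore hl₀ (i := regAddr B 0) (e := .reg 0)
    trivial (by simp [Expr.LogFree])
  have hσ₁ : Prepared I d σ₁ := hσ.frame e₁.frame (by simp [logStore, Prog.WritesReg])
    (by simp [logStore, Prog.WritesArr])
  have hr₁ : Represents B ((⟨fun _ => 0, fun _ _ => 0⟩ : State).setReg 0 I.n) σ₁ :=
    hr₀.setReg 0 _ fun w => by rw [hv₁]; simp only [Expr.val, regAddr, hσ.reg_n]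
  have h8₁ : σ₁.arrs 8 = σ.arrs 8 := e₁.frame.arrs 8 (by simp [logStore, Prog.WritesArr])
  have h5₁ : σ₁.regs 5 = c := (e₁.frame.regs 5 (by simp [logStore, Prog.WritesReg])).trans h5
  obtain ⟨σ₂, e₂, hl₂, hv₂⟩ := exec_logStore hl₁ (i := regAddr B 1) (e := .reg 1)
    trivial (by simp [Expr.LogFree])
  have hσ₂ : Prepared I d σ₂ := hσ₁.frame e₂.frame (by simp [logStore, Prog.WritesReg])
    (by simp [logStore, Prog.WritesArr])
  have hr₂ : Represents B
      (((⟨fun _ => 0, fun _ _ => 0⟩ : State).setReg 0 I.n).setReg 1 I.m) σ₂ :=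
    hr₁.setReg 1 _ fun w => by rw [hv₂]; simp only [Expr.val, regAddr, hσ₁.reg_m]
  have h8₂ : σ₂.arrs 8 = σ₁.arrs 8 := e₂.frame.arrs 8 (by simp [logStore, Prog.WritesArr])
  have h5₂ : σ₂.regs 5 = c := (e₂.frame.regs 5 (by simp [logStore, Prog.WritesReg])).trans h5₁
  obtain ⟨t₃, σ₃, e₃, ht₃, hl₃, hr₃⟩ := halts_loadMatrix hB b hσ₂ hl₂
    (represents_partialInput_zero _ _ hr₂)
  have hσ₃ : Prepared I d σ₃ := hσ₂.frame e₃.frame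
    (by simp [loadMatrix, forLoop, logStore, Prog.WritesReg])
    (by simp [loadMatrix, forLoop, logStore, Prog.WritesArr])
  have h8₃ : σ₃.arrs 8 = σ₂.arrs 8 :=
    e₃.frame.arrs 8 (by simp [loadMatrix, forLoop, logStore, Prog.WritesArr])
  have h5₃ : σ₃.regs 5 = c :=
    (e₃.frame.regs 5 (by simp [loadMatrix, forLoop, logStore, Prog.WritesReg])).trans h5₂
  obtain ⟨t₄, σ₄, e₄, ht₄, hl₄, hr₄⟩ := halts_loadRhs hB hσ₃ h5₃ hl₃ hr₃
  have h8₄ : σ₄.arrs 8 = σ₃.arrs 8 :=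
    e₄.frame.arrs 8 (by simp [loadRhs, forLoop, logStore, Prog.WritesArr])
  have h5₄ : σ₄.regs 5 = c :=
    (e₄.frame.regs 5 (by simp [loadRhs, forLoop, logStore, Prog.WritesReg])).trans h5₃
  rw [← hb, partialInput_eq_lpInput] at hr₄
  obtain ⟨t₅, k, σ₅, e₅, ht₅, hk, hr₅, hl₅⟩ := hρ.translate hSB σ₄ _ hr₄ hl₄
  have h8₅ : σ₅.arrs 8 = σ₄.arrs 8 := e₅.frame.arrs 8 fun h => by
    have := Prog.of_writesArr_translate h
    omega
  have h5₅ : σ₅.regs 5 = c := (e₅.frame.regs 5 fun h => by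
    have := Prog.eq_of_writesReg_translate h
    omega).trans h5₄
  have h0 : σ₅.arrs 6 0 = ρ.regs 0 := by simpa using hr₅.regs 0
  rw [BoundariedILP.lpFeasible_fixed_iff hI hA] at hans
  -- The budget `260 * g` is spent as 10 for each of the two registers, 46 for the matrix, 107 for
  -- the right-hand side and 16 for the simulation. The remaining 71 cover the recording of the
  -- answer and the clearing.
  refine Halts.seq _ (250 * g I.n I.m) ?_ ⟨_, σ₁, e₁, le_rfl, ?_⟩
  · simp only [regAddr, Expr.cost]; omega
  refine Halts.seq _ (240 * g I.n I.m) ?_ ⟨_, σ₂, e₂, le_rfl, ?_⟩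
  · simp only [regAddr, Expr.cost]; omega
  refine Halts.seq _ (194 * g I.n I.m) ?_ ⟨_, σ₃, e₃, ht₃, ?_⟩
  · nlinarith
  refine Halts.seq _ (87 * g I.n I.m) ?_ ⟨_, σ₄, e₄, ht₄, ?_⟩
  · nlinarith
  refine Halts.seq (16 * g I.n I.m) (71 * g I.n I.m) (by omega) ⟨_, σ₅, e₅, by omega, ?_⟩
  -- The log has at most `2 + m * n + m + t ≤ 2 + 2 * g` entries: those from loading the input and
  -- those from the simulated run.
  refine Halts.seq 14 (11 * k + 3) (by omega) ?_
  have hrec : Halts recordAnswer σ₅ 14 fun σ' => Logged k σ' ∧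
      (∀ z : ℤ, z ≠ c → σ'.arrs 8 z = σ.arrs 8 z) ∧
        (σ'.arrs 8 c = 0 ∨ σ'.arrs 8 c = 1) ∧
        (σ'.arrs 8 c = 1 ↔ (fun k : Fin r => (digit d k c : ℤ)) ∈ I.feasibleBoundary) := by
    refine Halts.condEq (by simp [Expr.cost]) (fun h => ?_) fun h => ?_ <;>
      refine Halts.store (by simp [Expr.cost]) ⟨hl₅.congr rfl rfl rfl, fun z hz => ?_, ?_⟩
    · simp [Expr.val, h5₅, hz, h8₅, h8₄, h8₃, h8₂, h8₁]
    · simp only [Expr.val, h0] at h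
      simp [Expr.val, h5₅, hans.1 h]
    · simp [Expr.val, h5₅, hz, h8₅, h8₄, h8₃, h8₂, h8₁]
    · simp only [Expr.val, h0] at h
      have h' := mt hans.2 h
      simpa [Expr.val, h5₅] using h'
  refine hrec.mono le_rfl ?_
  rintro σ₆ - ⟨hl₆, h₁, h₂, h₃⟩
  refine (halts_clearLog hl₆).mono le_rfl ?_
  rintro σ₇ hf ⟨hz, hc⟩
  have h8 : σ₇.arrs 8 = σ₆.arrs 8 := hf.arrs 8 (by simp [clearLog, Prog.WritesArr])
  rw [h8]
  exact ⟨hc, hz, h₁, h₂, h₃⟩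

/-! ### Feasibility of all boundary assignments -/

/-- Decide for all boundary assignments whether they are feasible. -/
def solveAll (S : Prog) (B : ℕ) : Prog := forLoop 5 4 (solveOne S B)

/-- The loop counter is itself the number of the assignment. Clean simulated memory is part of the
invariant, and earlier answers persist because round `c` changes the array `8` only in cell `c`. -/
theorem halts_solveAll {S : Prog} {g : ℕ → ℕ → ℕ} (hS : IsLPSolver S g) {B : ℕ}
    (hB : 2 ≤ B) (hSB : S.arrBound ≤ B) {I : BoundariedILP r} {d : ℕ} (hI : I.HasDomainSize d)
    (hA : I.innerMatrix.IsTotallyUnimodular) {σ : State} (hσ : Prepared I d σ)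
    (h6 : σ.regs 6 = 0) (h6' : σ.arrs 6 = 0) :
    Halts (solveAll S B) σ (d ^ r * (260 * g I.n I.m + 9) + 7) fun σ' =>
      Prepared I d σ' ∧ ∀ c < d ^ r, (σ'.arrs 8 (c : ℕ) = 0 ∨ σ'.arrs 8 (c : ℕ) = 1) ∧
        (σ'.arrs 8 (c : ℕ) = 1 ↔
          (fun k : Fin r => (digit d k c : ℤ)) ∈ I.feasibleBoundary) := by
  have hW : ∀ x, ¬ x ∈ [6, 7, 8, 9] → ¬ (solveOne S B).WritesReg x :=
    fun x hx h => hx (solveOne_writesReg h)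
  have hW' : ∀ x, x ∈ [0, 1, 2, 3, 4, 10] → ¬ (solveAll S B).WritesReg x := by
    intro x hx h
    rcases h with h | h | h
    · rw [h] at hx; simp at hx
    · have := solveOne_writesReg h
      simp at hx this; omega
    · rw [h] at hx; simp at hx
  have hA' : ∀ a, a ∈ [0, 1, 2, 9, 10] → ¬ (solveAll S B).WritesArr a := by
    intro a ha h
    rcases h with h | h | h
    · exact h
    · have := solveOne_writesArr h
      simp at ha this; omega
    · exact h
  refine Halts.mono (Halts.forLoop (N := d ^ r) (T := 260 * g I.n I.m) (fun k σ' =>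
    σ'.regs 6 = 0 ∧ σ'.arrs 6 = 0 ∧
      ∀ c < k, (σ'.arrs 8 (c : ℕ) = 0 ∨ σ'.arrs 8 (c : ℕ) = 1) ∧
        (σ'.arrs 8 (c : ℕ) = 1 ↔
          (fun k : Fin r => (digit d k c : ℤ)) ∈ I.feasibleBoundary)) hσ.reg_pow (by decide)
    (hW 5 (by simp)) (hW 4 (by simp)) ⟨by simpa using h6, h6', by simp⟩ ?_) le_rfl ?_
  · rintro c hc τ hf h5 ⟨h₁, h₂, h₃⟩
    have hτ : Prepared I d τ := hσ.frame hf hW' hA'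
    refine Halts.mono (halts_solveOne hS hB hSB hI hA hτ h5 h₁ h₂) le_rfl ?_
    rintro τ' - ⟨g₁, g₂, g₃, g₄, g₅⟩
    refine ⟨by simpa using g₁, g₂, fun c' hc' => ?_⟩
    simp only [State.setReg_arrs]
    rcases Nat.lt_succ_iff_lt_or_eq.1 hc' with hc' | rfl
    · rw [g₃ (c' : ℕ) (by omega)]
      exact h₃ c' hc'
    · exact ⟨g₄, g₅⟩
  · rintro σ' hf ⟨-, -, h⟩
    exact ⟨hσ.frame hf hW' hA', h⟩

/-! ### Writing the output -/

/-- Write the entry in row `14`, column `15` into the cell `7` of the array `3`, given half the row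
in register `16` and the sign in register `17`. -/
def storeEntry : Prog :=
  .cond (.add (.reg 16) (.const 1)) (.reg 11)
    (condEq (.reg 15) (.reg 16) (.store 3 (.reg 7) (.reg 17)) (.store 3 (.reg 7) (.const 0)))
    (.cond (.add (.reg 16) (.const 1)) (.add (.reg 11) (.reg 2))
      (.cond (.add (.reg 15) (.const 1)) (.reg 2)
        (condEq (.reg 15) (.sub (.reg 16) (.reg 11)) (.store 3 (.reg 7) (.reg 17))
          (.store 3 (.reg 7) (.const 0)))
        (.store 3 (.reg 7) (.mul (.reg 17) (.sub (.const 0)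
          (digitExpr (.sub (.reg 16) (.reg 11)) (.sub (.add (.reg 15) (.const 1)) (.reg 2)))))))
      (.cond (.add (.reg 15) (.const 1)) (.reg 2) (.store 3 (.reg 7) (.const 0))
        (.store 3 (.reg 7) (.reg 17))))

theorem halts_storeEntry {σ : State} {N d p j h : ℕ} {s : ℤ} (h2 : σ.regs 2 = r)
    (h3 : σ.regs 3 = d) (h7 : σ.regs 7 = p) (h11 : σ.regs 11 = N) (h15 : σ.regs 15 = j)
    (h16 : σ.regs 16 = h) (h17 : σ.regs 17 = s)
    (h9 : ∀ k ≤ r, σ.arrs 9 (k : ℕ) = ((d ^ k : ℕ) : ℤ)) :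
    Halts storeEntry σ 70 fun σ' => σ'.arrs 3 p = s * outBase N r d h j ∧
      ∀ z : ℤ, z ≠ p → σ'.arrs 3 z = σ.arrs 3 z := by
  have store : ∀ (e : Expr) (T : ℕ), e.cost + 2 ≤ T → e.val σ = s * outBase N r d h j →
      Halts (.store 3 (.reg 7) e) σ T fun σ' => σ'.arrs 3 p = s * outBase N r d h j ∧
        ∀ z : ℤ, z ≠ p → σ'.arrs 3 z = σ.arrs 3 z := by
    intro e T hT he
    refine Halts.store (by simp only [Expr.cost]; omega) ⟨?_, fun z hz => ?_⟩
    · simp only [State.setArr_arrs_self, Expr.val, h7, if_true, he]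
    · simp [Expr.val, h7, hz]
  refine Halts.cond (by simp [Expr.cost]) (fun c₁ => ?_) fun c₁ => ?_ <;>
    simp only [Expr.val, h16, h11] at c₁
  · have c₁' : h < N := by omega
    refine Halts.condEq (by simp [Expr.cost]) (fun c₂ => ?_) fun c₂ => ?_ <;>
      simp only [Expr.val, h15, h16] at c₂ <;> refine store _ _ (by simp [Expr.cost]) ?_
    · have c₂' : j = h := by omega
      simp [Expr.val, h17, outBase, c₁', c₂']
    · have c₂' : j ≠ h := by omega
      simp [Expr.val, outBase, c₁', c₂']
  have c₁' : ¬ h < N := by omega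
  refine Halts.cond (by simp [Expr.cost]) (fun c₂ => ?_) fun c₂ => ?_ <;>
    simp only [Expr.val, h16, h11, h2] at c₂
  · have c₂' : h < N + r := by omega
    refine Halts.cond (by simp [Expr.cost]) (fun c₃ => ?_) fun c₃ => ?_ <;>
      simp only [Expr.val, h15, h2] at c₃
    · have c₃' : j < r := by omega
      refine Halts.condEq (by simp [Expr.cost]) (fun c₄ => ?_) fun c₄ => ?_ <;>
        simp only [Expr.val, h15, h16, h11] at c₄ <;> refine store _ _ (by simp [Expr.cost]) ?_
      · have c₄' : j = h - N := by omega
        rw [outBase, if_neg c₁', if_pos c₂', if_pos c₃', if_pos c₄']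
        simp [Expr.val, h17]
      · have c₄' : j ≠ h - N := by omega
        simp [Expr.val, outBase, c₁', c₂', c₃', c₄']
    · have c₃' : ¬ j < r := by omega
      refine store _ _ (by simp [Expr.cost, digitExpr]) ?_
      -- On this branch `N ≤ h` and `r ≤ j`, so the machine's integer differences agree with the
      -- truncated ones in `outBase`.
      have hd := digitExpr_val h3 h9 (k := h - N) (c := j + 1 - r) (by omega)
        (ek := .sub (.reg 16) (.reg 11)) (ec := .sub (.add (.reg 15) (.const 1)) (.reg 2))
        (by simp only [Expr.val, h16, h11]; omega) (by simp only [Expr.val, h15, h2]; omega)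
      simp only [Expr.val, h17, hd, outBase, c₁', c₂', c₃', if_true, if_false]
      ring
  · have c₂' : ¬ h < N + r := by omega
    refine Halts.cond (by simp [Expr.cost]) (fun c₃ => ?_) fun c₃ => ?_ <;>
      simp only [Expr.val, h15, h2] at c₃ <;> refine store _ _ (by simp [Expr.cost]) ?_
    · have c₃' : j < r := by omega
      simp [Expr.val, outBase, c₁', c₂', c₃']
    · have c₃' : ¬ j < r := by omega
      simp [Expr.val, h17, outBase, c₁', c₂', c₃']

/-- Write the output matrix. -/
def writeMatrix : Prog :=
  forLoop 7 13 (.seq (.assign 14 (.div (.reg 7) (.reg 11)))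
    (.seq (.assign 15 (.sub (.reg 7) (.mul (.reg 11) (.reg 14))))
      (.seq (.assign 16 (.div (.reg 14) (.const 2)))
        (.seq (.assign 17 (.sub (.const 1)
          (.mul (.const 2) (.sub (.reg 14) (.mul (.const 2) (.reg 16))))))
          storeEntry))))

theorem halts_writeMatrix {I : BoundariedILP r} {N M d : ℕ} {σ : State} (hσ : Prepared I d σ)
    (h11 : σ.regs 11 = N) (h13 : σ.regs 13 = ((M * N : ℕ) : ℤ)) :
    Halts writeMatrix σ (M * N * 110 + 7) fun σ' => ∀ q < M * N,
      σ'.arrs 3 (q : ℕ) = outEntry N r d (q / N) (q % N) := by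
  refine Halts.mono (Halts.forLoop (N := M * N) (T := 101) (fun p σ' => ∀ q < p,
    σ'.arrs 3 (q : ℕ) = outEntry N r d (q / N) (q % N)) h13 (by decide)
    (by simp [Prog.WritesReg, storeEntry, condEq]) (by simp [Prog.WritesReg, storeEntry, condEq])
    (by simp) ?_) (by omega) fun _ _ h => h
  rintro p hp τ hf h7 hI
  have hτ : Prepared I d τ := hσ.frame hf
    (by simp [RAM.forLoop, Prog.WritesReg, storeEntry, condEq])
    (by simp [RAM.forLoop, Prog.WritesArr, storeEntry, condEq])
  have h11' : τ.regs 11 = N := (hf.regs 11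
    (by simp [RAM.forLoop, Prog.WritesReg, storeEntry, condEq])).trans h11
  refine Halts.assign_seq (by simp [Expr.cost]) (Halts.assign_seq (by simp [Expr.cost])
    (Halts.assign_seq (by simp [Expr.cost]) (Halts.assign_seq (by simp [Expr.cost]) ?_)))
  -- Remainders are again obtained from quotients: the first gives the column, the second the parity
  -- of the row, which decides the sign.
  have hmod : (p : ℤ) - N * ((p : ℤ) / N) = (p % N : ℕ) := by
    rw [← Int.emod_def]; simp
  have hmod₂ : (p : ℤ) / N - 2 * ((p : ℤ) / N / 2) = (p / N % 2 : ℕ) := by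
    rw [← Int.emod_def]; simp
  refine Halts.mono (halts_storeEntry (r := r) (N := N) (d := d) (p := p) (j := p % N)
    (h := p / N / 2) (s := 1 - 2 * ((p / N % 2 : ℕ) : ℤ)) ?_ ?_ ?_ ?_ ?_ ?_ ?_ ?_)
    (by simp [Expr.cost]) ?_
  · simp [hτ.reg_r]
  · simp [hτ.reg_d]
  · simp [h7]
  · simp [h11']
  · simp only [State.setReg_regs, Expr.val, h7, h11']
    simpa using hmod
  · simp [Expr.val, h7, h11']
  · simp only [State.setReg_regs, Expr.val, h7, h11']
    simpa using hmod₂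
  · exact hτ.pow
  · rintro τ' - ⟨h₁, h₂⟩ q hq
    simp only [State.setReg_arrs]
    rcases Nat.lt_succ_iff_lt_or_eq.1 hq with hq | rfl
    · rw [h₂ (q : ℕ) (by omega)]
      exact hI q hq
    · exact h₁

/-- Write the output right-hand side. -/
def writeRhs : Prog :=
  forLoop 7 12 (.seq (.assign 16 (.div (.reg 7) (.const 2)))
    (condEq (.reg 7) (.mul (.const 2) (.reg 16))
      (.cond (.add (.reg 16) (.const 1)) (.reg 2)
        (.store 4 (.reg 7) (.sub (.reg 3) (.const 1)))
        (.cond (.add (.reg 16) (.const 1)) (.reg 11)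
          (.store 4 (.reg 7) (.get 8 (.sub (.add (.reg 16) (.const 1)) (.reg 2))))
          (.cond (.add (.reg 16) (.const 1)) (.add (.reg 11) (.reg 2))
            (.store 4 (.reg 7) (.const 0)) (.store 4 (.reg 7) (.const 1)))))
      (.cond (.add (.reg 16) (.const 1)) (.add (.reg 11) (.reg 2))
        (.store 4 (.reg 7) (.const 0))
        (.store 4 (.reg 7) (.sub (.get 8 (.const 0)) (.const 1))))))

theorem halts_writeRhs {I : BoundariedILP r} {N M d : ℕ} {σ : State} (hσ : Prepared I d σ)
    (h11 : σ.regs 11 = N) (h12 : σ.regs 12 = M) :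
    Halts writeRhs σ (M * 70 + 7) fun σ' => ∀ q < M,
      σ'.arrs 4 (q : ℕ) = outRhs N r d (fun c => σ.arrs 8 (c : ℕ)) q := by
  refine Halts.mono (Halts.forLoop (N := M) (T := 61) (fun p σ' => ∀ q < p,
    σ'.arrs 4 (q : ℕ) = outRhs N r d (fun c => σ.arrs 8 (c : ℕ)) q) h12 (by decide)
    (by simp [Prog.WritesReg, condEq]) (by simp [Prog.WritesReg, condEq])
    (by simp) ?_) (by omega) fun _ _ h => h
  rintro p hp τ hf h7 hI
  have hτ : Prepared I d τ := hσ.frame hf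
    (by simp [RAM.forLoop, Prog.WritesReg, condEq])
    (by simp [RAM.forLoop, Prog.WritesArr, condEq])
  have h11' : τ.regs 11 = N := (hf.regs 11
    (by simp [RAM.forLoop, Prog.WritesReg, condEq])).trans h11
  have h8 : τ.arrs 8 = σ.arrs 8 := hf.arrs 8 (by simp [RAM.forLoop, Prog.WritesArr, condEq])
  refine Halts.assign_seq (by simp [Expr.cost]) ?_
  set τ₁ := τ.setReg 16 ((Expr.div (.reg 7) (.const 2)).val τ) with hτ₁
  have h2₁ : τ₁.regs 2 = r := by simp [hτ₁, hτ.reg_r]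
  have h3₁ : τ₁.regs 3 = d := by simp [hτ₁, hτ.reg_d]
  have h7₁ : τ₁.regs 7 = p := by simp [hτ₁, h7]
  have h11₁ : τ₁.regs 11 = N := by simp [hτ₁, h11']
  have h16₁ : τ₁.regs 16 = (p / 2 : ℕ) := by simp [hτ₁, Expr.val, h7]
  have h8₁ : τ₁.arrs 8 = σ.arrs 8 := h8
  have store : ∀ (e : Expr) (T : ℕ), e.cost + 2 ≤ T →
      e.val τ₁ = outRhs N r d (fun c => σ.arrs 8 (c : ℕ)) p →
      Halts (.store 4 (.reg 7) e) τ₁ T fun σ' => ∀ q < p + 1,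
        (σ'.setReg 7 (p + 1)).arrs 4 (q : ℕ) =
          outRhs N r d (fun c => σ.arrs 8 (c : ℕ)) q := by
    intro e T hT he
    refine Halts.store (by simp only [Expr.cost]; omega) fun q hq => ?_
    simp only [State.setReg_arrs, State.setArr_arrs_self, Expr.val, h7₁, he]
    rcases Nat.lt_succ_iff_lt_or_eq.1 hq with hq | rfl
    · rw [if_neg (by omega)]
      exact hI q hq
    · simp
  refine Halts.condEq (by simp [Expr.cost]) (fun c₁ => ?_) fun c₁ => ?_ <;>
    simp only [Expr.val, h7₁, h16₁] at c₁
  · have c₁' : p % 2 = 0 := by omega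
    refine Halts.cond (by simp [Expr.cost]) (fun c₂ => ?_) fun c₂ => ?_ <;>
      simp only [Expr.val, h16₁, h2₁] at c₂
    · have c₂' : p / 2 < r := by omega
      refine store _ _ (by simp [Expr.cost]) ?_
      simp [Expr.val, h3₁, outRhs, c₁', c₂']
    have c₂' : ¬ p / 2 < r := by omega
    refine Halts.cond (by simp [Expr.cost]) (fun c₃ => ?_) fun c₃ => ?_ <;>
      simp only [Expr.val, h16₁, h11₁] at c₃
    · have c₃' : p / 2 < N := by omega
      refine store _ _ (by simp [Expr.cost]) ?_
      -- Truncation is harmless here because `r ≤ p / 2` on this branch.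
      have e : ((p / 2 : ℕ) : ℤ) + 1 - r = (p / 2 + 1 - r : ℕ) := by omega
      simp only [Expr.val, h16₁, h2₁, h8₁, outRhs, c₁', c₂', c₃', if_true, if_false, e]
    have c₃' : ¬ p / 2 < N := by omega
    refine Halts.cond (by simp [Expr.cost]) (fun c₄ => ?_) fun c₄ => ?_ <;>
      simp only [Expr.val, h16₁, h11₁, h2₁] at c₄ <;> refine store _ _ (by simp [Expr.cost]) ?_
    · have c₄' : p / 2 < N + r := by omega
      simp [Expr.val, outRhs, c₁', c₂', c₃', c₄']
    · have c₄' : ¬ p / 2 < N + r := by omega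
      simp [Expr.val, outRhs, c₁', c₂', c₃', c₄']
  · have c₁' : ¬ p % 2 = 0 := by omega
    refine Halts.cond (by simp [Expr.cost]) (fun c₂ => ?_) fun c₂ => ?_ <;>
      simp only [Expr.val, h16₁, h11₁, h2₁] at c₂ <;> refine store _ _ (by simp [Expr.cost]) ?_
    · have c₂' : p / 2 < N + r := by omega
      simp only [Expr.val, outRhs, c₁', c₂', if_true, if_false]
    · have c₂' : ¬ p / 2 < N + r := by omega
      simp [Expr.val, h8₁, outRhs, c₁', c₂']

/-- Write the indices of the boundary variables of the output. -/
def writeBoundary : Prog := forLoop 7 2 (.store 5 (.reg 7) (.reg 7))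

theorem halts_writeBoundary {σ : State} (h2 : σ.regs 2 = r) :
    Halts writeBoundary σ (r * 12 + 7) fun σ' => ∀ k < r, σ'.arrs 5 (k : ℕ) = (k : ℕ) := by
  refine Halts.mono (Halts.forLoop (N := r) (T := 3) (fun p σ' => ∀ k < p,
    σ'.arrs 5 (k : ℕ) = (k : ℕ)) h2 (by decide) (by simp [Prog.WritesReg])
    (by simp [Prog.WritesReg]) (by simp) ?_) (by omega) fun _ _ h => h
  rintro p hp τ - h7 hI
  refine Halts.store (by simp [Expr.cost]) fun k hk => ?_
  simp only [State.setReg_arrs, State.setArr_arrs_self, Expr.val, h7]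
  split_ifs with h
  · exact h.symm
  · exact hI k (by omega)

/-- Write the output. -/
def writeOutput : Prog :=
  .seq (.assign 11 (.sub (.add (.reg 2) (.reg 4)) (.const 1)))
    (.seq (.assign 12 (.mul (.const 2) (.add (.add (.reg 11) (.reg 2)) (.const 1))))
      (.seq (.assign 13 (.mul (.reg 12) (.reg 11)))
        (.seq writeMatrix (.seq writeRhs (.seq writeBoundary
          (.seq (.assign 0 (.reg 11)) (.assign 1 (.reg 12))))))))

theorem halts_writeOutput {I : BoundariedILP r} {d : ℕ} (hd : 1 ≤ d) {σ : State}
    (hσ : Prepared I d σ) :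
    Halts writeOutput σ (2 * (outVars r d + r + 1) * outVars r d * 110 +
      2 * (outVars r d + r + 1) * 70 + r * 12 + 50) fun σ' =>
        (outILP r d hd fun c => σ.arrs 8 (c : ℕ)).IsOutput σ' := by
  have hpow := Nat.one_le_pow r d hd
  set N := outVars r d with hN
  set M := 2 * (N + r + 1) with hM
  set F : ℕ → ℤ := fun c => σ.arrs 8 (c : ℕ) with hF
  refine Halts.assign_seq (by simp [Expr.cost]) (Halts.assign_seq (by simp [Expr.cost])
    (Halts.assign_seq (by simp [Expr.cost]) ?_))
  set σ₁ := ((σ.setReg 11 ((Expr.sub (.add (.reg 2) (.reg 4)) (.const 1)).val σ)).setReg 12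
    ((Expr.mul (.const 2) (.add (.add (.reg 11) (.reg 2)) (.const 1))).val
      (σ.setReg 11 ((Expr.sub (.add (.reg 2) (.reg 4)) (.const 1)).val σ)))).setReg 13
    ((Expr.mul (.reg 12) (.reg 11)).val
      ((σ.setReg 11 ((Expr.sub (.add (.reg 2) (.reg 4)) (.const 1)).val σ)).setReg 12
        ((Expr.mul (.const 2) (.add (.add (.reg 11) (.reg 2)) (.const 1))).val
          (σ.setReg 11 ((Expr.sub (.add (.reg 2) (.reg 4)) (.const 1)).val σ))))) with hσ₁
  have hNz : (r : ℤ) + ((d ^ r : ℕ) : ℤ) - 1 = N := by simp only [hN, outVars]; omega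
  have h11 : σ₁.regs 11 = N := by
    simp only [hσ₁, State.setReg_regs, Expr.val, hσ.reg_r, hσ.reg_pow, hNz]
    simp
  have h12 : σ₁.regs 12 = M := by
    simp only [hσ₁, State.setReg_regs, Expr.val, hσ.reg_r, hσ.reg_pow, hNz]
    simp [hM]
  have h13 : σ₁.regs 13 = ((M * N : ℕ) : ℤ) := by
    simp only [hσ₁, State.setReg_regs, Expr.val, hσ.reg_r, hσ.reg_pow, hNz]
    simp [hM]
  have h8₁ : σ₁.arrs 8 = σ.arrs 8 := rfl
  have hp₁ : Prepared I d σ₁ := by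
    constructor
    · simp [hσ₁, hσ.reg_n]
    · simp [hσ₁, hσ.reg_m]
    · simp [hσ₁, hσ.reg_r]
    · simp [hσ₁, hσ.reg_d]
    · simp [hσ₁, hσ.reg_pow]
    · simp [hσ₁, hσ.reg_mul]
    · exact hσ.matrix
    · exact hσ.rhs
    · exact hσ.boundary
    · exact hσ.pow
    · exact hσ.marked
  clear_value σ₁
  refine Halts.seq (M * N * 110 + 7) (M * 70 + 7 + (r * 12 + 7 + 4))
    (by simp only [Expr.cost]; omega) ?_
  refine Halts.mono (halts_writeMatrix hp₁ h11 h13) le_rfl ?_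
  intro σ₂ hf₂ h3
  have hp₂ : Prepared I d σ₂ := hp₁.frame hf₂
    (by simp [writeMatrix, forLoop, Prog.WritesReg, storeEntry, condEq])
    (by simp [writeMatrix, forLoop, Prog.WritesArr, storeEntry, condEq])
  have h11₂ : σ₂.regs 11 = N := (hf₂.regs 11
    (by simp [writeMatrix, forLoop, Prog.WritesReg, storeEntry, condEq])).trans h11
  have h12₂ : σ₂.regs 12 = M := (hf₂.regs 12
    (by simp [writeMatrix, forLoop, Prog.WritesReg, storeEntry, condEq])).trans h12
  have h8₂ : σ₂.arrs 8 = σ.arrs 8 := (hf₂.arrs 8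
    (by simp [writeMatrix, forLoop, Prog.WritesArr, storeEntry, condEq])).trans h8₁
  refine Halts.seq _ _ le_rfl (Halts.mono (halts_writeRhs hp₂ h11₂ h12₂) le_rfl ?_)
  intro σ₃ hf₃ h4
  rw [h8₂, ← hF] at h4
  have h2₃ : σ₃.regs 2 = r := (hf₃.regs 2
    (by simp [writeRhs, forLoop, Prog.WritesReg, condEq])).trans hp₂.reg_r
  have h11₃ : σ₃.regs 11 = N := (hf₃.regs 11
    (by simp [writeRhs, forLoop, Prog.WritesReg, condEq])).trans h11₂
  have h12₃ : σ₃.regs 12 = M := (hf₃.regs 12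
    (by simp [writeRhs, forLoop, Prog.WritesReg, condEq])).trans h12₂
  have h3₃ : σ₃.arrs 3 = σ₂.arrs 3 := hf₃.arrs 3
    (by simp [writeRhs, forLoop, Prog.WritesArr, condEq])
  refine Halts.seq _ _ le_rfl (Halts.mono (halts_writeBoundary h2₃) le_rfl ?_)
  intro σ₄ hf₄ h5
  have h11₄ : σ₄.regs 11 = N := (hf₄.regs 11
    (by simp [writeBoundary, forLoop, Prog.WritesReg])).trans h11₃
  have h12₄ : σ₄.regs 12 = M := (hf₄.regs 12
    (by simp [writeBoundary, forLoop, Prog.WritesReg])).trans h12₃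
  have h3₄ : σ₄.arrs 3 = σ₂.arrs 3 := (hf₄.arrs 3
    (by simp [writeBoundary, forLoop, Prog.WritesArr])).trans h3₃
  have h4₄ : σ₄.arrs 4 = σ₃.arrs 4 := hf₄.arrs 4
    (by simp [writeBoundary, forLoop, Prog.WritesArr])
  refine Halts.assign_seq (by simp [Expr.cost]) (Halts.assign (by simp [Expr.cost]) ?_)
  refine ⟨?_, ?_, fun i j => ?_, fun i => ?_, fun k => ?_⟩
  · simp [Expr.val, h11₄, outILP, hN]
  · simp [Expr.val, h12₄, outILP, hM, hN]
  · have hi : (i : ℕ) < M := i.2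
    have hj : (j : ℕ) < N := j.2
    have hlt : (i : ℕ) * N + j < M * N := by
      have := Nat.mul_le_mul_right N (show (i : ℕ) + 1 ≤ M from hi)
      nlinarith
    have := h3 _ hlt
    rw [Nat.mul_comm, Nat.mul_add_div (by omega), Nat.div_eq_of_lt hj, add_zero,
      Nat.mul_add_mod, Nat.mod_eq_of_lt hj, mul_comm N] at this
    push_cast at this
    simp only [State.setReg_arrs, h3₄]
    exact this
  · have := h4 i i.2
    simp only [State.setReg_arrs, h4₄]
    exact this
  · simp only [State.setReg_arrs]
    exact h5 k k.2

/-! ### The whole algorithm and its running time -/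

/-- The entire algorithm. -/
def reductionProg (S : Prog) (B : ℕ) : Prog :=
  .seq prepProg (.seq (solveAll S B) writeOutput)

/-- Writing the output matrix takes time of order `(r + D) ^ 2` with `D = d ^ r`. The part `D * D`
is allowed explicitly; the parts with `r` are charged to the solver, since `r * r ≤ m * n ≤ g`. -/
theorem running_time_le {r d n m g : ℕ} (hd : 1 ≤ d) (hrn : r ≤ n) (hnm : 2 * n ≤ m)
    (hg : m * n + m ≤ g) (hg1 : 1 ≤ g) :
    31 * r + 23 + (d ^ r * (260 * g + 9) + 7 + (2 * (outVars r d + r + 1) * outVars r d * 110 +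
      2 * (outVars r d + r + 1) * 70 + r * 12 + 50)) ≤ 4000 * (d ^ r * g + d ^ (2 * r)) := by
  have hD : 1 ≤ d ^ r := Nat.one_le_pow r d hd
  have hN : outVars r d + 1 = r + d ^ r := by unfold outVars; omega
  have h₀ : d ^ (2 * r) = d ^ r * d ^ r := by rw [two_mul, pow_add]
  rw [h₀]
  clear h₀
  generalize d ^ r = D at *
  generalize outVars r d = N at *
  have h₁ : r * r ≤ g := by
    have := Nat.mul_le_mul (show r ≤ m by omega) hrn
    omega
  have h₂ : r ≤ g := by nlinarith
  have h₃ : g ≤ D * g := Nat.le_mul_of_pos_left g hD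
  have h₄ : r * D ≤ D * g := by rw [mul_comm]; exact Nat.mul_le_mul_left D h₂
  have h₅ : 2 * (N + r + 1) * N ≤ 4 * (r * r) + 6 * (r * D) + 2 * (D * D) := by
    have hN' : N ≤ r + D := by omega
    calc 2 * (N + r + 1) * N ≤ 2 * (2 * r + D) * (r + D) :=
          Nat.mul_le_mul (by omega) hN'
      _ = _ := by ring
  have h₆ : D ≤ D * D := Nat.le_mul_of_pos_left D hD
  have h₇ : D * (260 * g + 9) = 260 * (D * g) + 9 * D := by ring
  rw [h₇]
  omega

end RAM

theorem lemma4p2 :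
    ∃ C : ℕ, ∀ (S : RAM.Prog) (g : ℕ → ℕ → ℕ), IsLPSolver S g →
      ∃ P : RAM.Prog, ∀ (r d : ℕ) (I : BoundariedILP r),
        1 ≤ d → I.HasDomainSize d → I.innerMatrix.IsTotallyUnimodular →
        ∃ (T : ℕ) (σ : RAM.State) (J : BoundariedILP r),
          RAM.Exec P (I.input d) T σ ∧
          T ≤ C * (d ^ r * g I.n I.m + d ^ (2 * r)) ∧
          J.IsOutput σ ∧
          I.Equivalent J ∧
          J.HasDomainSize d ∧
          J.n ≤ C * (r * d ^ r) ∧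
          J.m ≤ C * (max r 1 * d ^ r) ∧
          J.EntriesBounded d := by
  -- At least two simulated arrays are reserved, so the input matrix and right-hand side have a
  -- place even if the solver never mentions them.
  refine ⟨4000, fun S g hS => ⟨RAM.reductionProg S (max 2 S.arrBound), fun r d I hd hI hA => ?_⟩⟩
  obtain ⟨t₁, σ₁, e₁, ht₁, hσ₁, h6, h0⟩ := RAM.halts_prepProg I d
  obtain ⟨t₂, σ₂, e₂, ht₂, hσ₂, hF⟩ := RAM.halts_solveAll hS (le_max_left 2 S.arrBound)
    (le_max_right 2 S.arrBound) hI hA hσ₁ h6 (h0 6 (by simp))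
  obtain ⟨t₃, σ₃, e₃, ht₃, hout⟩ := RAM.halts_writeOutput hd hσ₂
  -- For `m = 0` the bound `m * n + m ≤ g` says nothing, but every run takes at least one step.
  have hg1 : 1 ≤ g I.n I.m := by
    obtain ⟨t, σ, he, ht, -⟩ := hS I.n I.m I.A I.b
    exact he.one_le.trans ht
  have hT := RAM.running_time_le hd I.le_n hI.two_mul_le (hS.le_runtime hI.two_mul_le) hg1
  have hD : 1 ≤ d ^ r := Nat.one_le_pow r d hd
  have hF₁ := fun c hc => (hF c hc).1
  refine ⟨_, σ₃, _, .seq _ _ _ _ _ _ _ e₁ (.seq _ _ _ _ _ _ _ e₂ e₃), by omega, hout, ?_,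
    hasDomainSize_outILP hd hF₁, ?_, ?_, entriesBounded_outILP hd hF₁⟩
  · refine Set.ext fun a => ?_
    rw [mem_feasibleBoundary_outILP hd hF₁]
    constructor
    · intro ha
      obtain ⟨x, hx, ht⟩ := id ha
      -- The domain constraints confine feasible boundary values to `{0, …, d - 1}`, so every
      -- feasible assignment has a number and was tested.
      obtain ⟨c, hc, hac⟩ := exists_digits a fun k => ht k ▸ hI.bounds hx (I.t k)
      refine ⟨c, hc, (hF c hc).2.2 ?_, hac⟩
      rwa [← funext hac]
    · rintro ⟨c, hc, hFc, hac⟩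
      rw [funext hac]
      exact (hF c hc).2.1 hFc
  -- For `r = 0` the allowed number of variables is zero, which is attained because the zero
  -- assignment has no indicator.
  · change r + d ^ r - 1 ≤ 4000 * (r * d ^ r)
    rcases Nat.eq_zero_or_pos r with rfl | hr
    · simp
    · have h₁ : r ≤ r * d ^ r := Nat.le_mul_of_pos_right r hD
      have h₂ : d ^ r ≤ r * d ^ r := Nat.le_mul_of_pos_left _ hr
      omega
  -- For `r = 0` the two rows bounding the empty sum remain; they record whether the instance is
  -- feasible, hence `max r 1`.
  · change 2 * (r + d ^ r - 1 + r + 1) ≤ 4000 * (max r 1 * d ^ r)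
    have h₁ : r ≤ max r 1 * d ^ r :=
      (le_max_left r 1).trans (Nat.le_mul_of_pos_right _ hD)
    have h₂ : d ^ r ≤ max r 1 * d ^ r := Nat.le_mul_of_pos_left _ (by omega)
    omega
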